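/- Let $0\le m\le n$ be integers, let $G(n,m)$ be the Grassmannian of $m$-dimensional linear subspaces of $\mathbb R^n$ with its $O(n)$-invariant Borel probability measure $\gamma_{n,m}$, and for $V\in G(n,m)$ let $P_V:\mathbb R^n\to V$ be the orthogonal projection. Let $\mu,\nu$ be Borel measures on $\mathbb R^n$ with compact supports $\operatorname{spt}\mu$, $\operatorname{spt}\nu$ and with $0<\mu(\mathbb R^n)<\infty$, $0<\nu(\mathbb R^n)<\infty$. For $s>0$ write $I_s(\mu)=\iint|x-y|^{-s}\,d\mu(x)\,d\mu(y)\in[0,\infty]$. (1) If $s,t>0$, $s+t=2m$, $I_s(\mu)<\infty$ and $I_t(\nu)<\infty$, then $$\gamma_{n,m}\bigl(\{V\in G(n,m): P_V(\operatorname{spt}\mu)\cap P_V(\operatorname{spt}\nu)\neq\emptyset\}\bigr)>0.$$ (2) If $s>2m$, $t>2m$, $I_s(\mu)<\infty$ and $I_t(\nu)<\infty$, then $$\gamma_{n,m}\bigl(\{V\in G(n,m): \operatorname{Int}\bigl(P_V(\operatorname{spt}\mu)\cap P_V(\operatorname{spt}\nu)\bigr)\neq\emptyset\}\bigr)>0,$$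 where $\operatorname{Int}$ denotes the interior relative to $V$. -/

import Mathlib

open MeasureTheory

noncomputable section

namespace ProjIntersect

/-- The Euclidean space `ℝⁿ`. -/
abbrev Eucl (n : ℕ) : Type := EuclideanSpace ℝ (Fin n)

/-- The class `𝓜(A)`: Borel measures `μ` on `ℝⁿ` with `0 < μ(A) < ∞` and with compact support
contained in `A`. -/
structure IsAdmissible {n : ℕ} (A : Set (Eucl n)) (μ : Measure (Eucl n)) : Prop where
  pos : 0 < μ A
  lt_top : μ A < ⊤
  isCompact_support : IsCompact μ.support
  support_subset : μ.support ⊆ A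

/-- The `s`-energy `I_s(μ) = ∬ |x - y|^{-s} dμ(x) dμ(y)`, with values in `[0, ∞]`
(for `s > 0` the integrand is `∞` on the diagonal). -/
def energy {n : ℕ} (s : ℝ) (μ : Measure (Eucl n)) : ENNReal :=
  ∫⁻ y, ∫⁻ x, ‖x - y‖ₑ ^ (-s) ∂μ ∂μ

/-- The Grassmannian `G(n,m)` of `m`-dimensional linear subspaces of `ℝⁿ`. -/
def Grassmannian (n m : ℕ) : Type :=
  {V : Submodule ℝ (Eucl n) // Module.finrank ℝ V = m}

/-- The topology of `G(n,m)` is that of the metric `d(V, W) = ‖P_V - P_W‖` (operator norm). -/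
instance (n m : ℕ) : TopologicalSpace (Grassmannian n m) :=
  TopologicalSpace.induced (fun V => V.1.starProjection) inferInstance

instance (n m : ℕ) : MeasurableSpace (Grassmannian n m) := borel _

instance (n m : ℕ) : BorelSpace (Grassmannian n m) := ⟨rfl⟩

/-- The orthogonal group `O(n)`, with the topology of the operator norm. -/
abbrev OrthGroup (n : ℕ) : Type := unitary (Eucl n →L[ℝ] Eucl n)

instance (n : ℕ) : ContinuousStar (Eucl n →L[ℝ] Eucl n) :=
  ⟨(ContinuousLinearMap.adjoint (𝕜 := ℝ) (E := Eucl n) (F := Eucl n)).continuous⟩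

instance (n : ℕ) : CompactSpace (OrthGroup n) := by
  refine isCompact_iff_compactSpace.mp ?_
  refine Metric.isCompact_of_isClosed_isBounded isClosed_unitary ?_
  refine isBounded_iff_forall_norm_le.mpr ⟨1, fun u hu => ?_⟩
  refine ContinuousLinearMap.opNorm_le_bound _ zero_le_one fun x => ?_
  rw [one_mul]
  exact ((Unitary.linearIsometryEquiv ⟨u, hu⟩).norm_map x).le

/-- The Haar probability measure of `O(n)`. -/
def orthHaar (n : ℕ) : Measure (OrthGroup n) := Measure.haarMeasure ⊤

/-- The coordinate plane spanned by the first `m` standard basis vectors of `ℝⁿ`. -/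
def coordPlane {n m : ℕ} (h : m ≤ n) : Grassmannian n m :=
  ⟨Submodule.span ℝ (Set.range fun i : Fin m =>
      EuclideanSpace.basisFun (Fin n) ℝ (Fin.castLE h i)), by
    have hli := (EuclideanSpace.basisFun (Fin n) ℝ).orthonormal.linearIndependent.comp
      (Fin.castLE h) (Fin.castLE_injective h)
    simpa [Function.comp_def] using finrank_span_eq_card hli⟩

/-- The action `(g, V) ↦ g V` of `O(n)` on `G(n,m)`. -/
def rotate {n m : ℕ} (g : OrthGroup n) (V : Grassmannian n m) : Grassmannian n m :=
  ⟨V.1.map (Unitary.linearIsometryEquiv g).toLinearEquiv.toLinearMap, by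
    rw [LinearEquiv.finrank_map_eq]; exact V.2⟩

/-- The measure `γ_{n,m}` on `G(n,m)`: the `O(n)`-invariant Borel probability measure,
`γ_{n,m}(𝒜) = θ_n {g ∈ O(n) : g V₀ ∈ 𝒜}` with `θ_n` the Haar probability measure. -/
def grassMeasure {n m : ℕ} (h : m ≤ n) : Measure (Grassmannian n m) :=
  (orthHaar n).map fun g => rotate g (coordPlane h)

theorem continuous_rotate {n m : ℕ} (V : Grassmannian n m) :
    Continuous fun g : OrthGroup n => rotate g V := by
  refine continuous_induced_rng.mpr ?_
  have h : ((fun V : Grassmannian n m => V.1.starProjection) ∘ fun g : OrthGroup n => rotate g V) =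
      fun g : OrthGroup n => (g : Eucl n →L[ℝ] Eucl n) * V.1.starProjection *
        star (g : Eucl n →L[ℝ] Eucl n) := by
    funext g
    ext1 x
    exact Submodule.starProjection_map_apply (Unitary.linearIsometryEquiv g) V.1 x
  rw [h]
  exact (continuous_subtype_val.mul continuous_const).mul continuous_subtype_val.star

instance {n m : ℕ} (h : m ≤ n) : IsProbabilityMeasure (grassMeasure h) := by
  have : IsProbabilityMeasure (orthHaar n) := ⟨by
    simpa [orthHaar] using Measure.haarMeasure_self (G := OrthGroup n) (K₀ := ⊤)⟩
  exact Measure.isProbabilityMeasure_map (continuous_rotate _).measurable.aemeasurable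

/-- The measure `γ_{n,m}` is invariant under the action of `O(n)`. -/
theorem map_rotate_grassMeasure {n m : ℕ} (h : m ≤ n) (g : OrthGroup n) :
    (grassMeasure h).map (rotate g) = grassMeasure h := by
  have hmul : ∀ (a b : OrthGroup n) (V : Grassmannian n m),
      rotate (a * b) V = rotate a (rotate b V) := by
    intro a b V
    apply Subtype.ext
    ext x
    simp only [rotate, map_mul]
    simp
    rfl
  have hc : Continuous (rotate g : Grassmannian n m → Grassmannian n m) := by
    refine continuous_induced_rng.mpr ?_
    have h : ((fun V : Grassmannian n m => V.1.starProjection) ∘ rotate g) =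
        fun V : Grassmannian n m => (g : Eucl n →L[ℝ] Eucl n) * V.1.starProjection *
          star (g : Eucl n →L[ℝ] Eucl n) := by
      funext V
      ext1 x
      exact Submodule.starProjection_map_apply (Unitary.linearIsometryEquiv g) V.1 x
    rw [h]
    exact (continuous_const.mul continuous_induced_dom).mul continuous_const
  have : Measure.IsMulLeftInvariant (orthHaar n) := by
    unfold orthHaar; infer_instance
  unfold grassMeasure
  conv_rhs => rw [← map_mul_left_eq_self (orthHaar n) g]
  rw [Measure.map_map hc.measurable (continuous_rotate _).measurable,
    Measure.map_map (continuous_rotate _).measurable (measurable_const_mul g)]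
  congr 1
  funext a
  exact (hmul g a _).symm

/-- The orthogonal projection `P_V(A)` of a set `A ⊆ ℝⁿ`, as a subset of the space `V`. -/
def projSet {n m : ℕ} (V : Grassmannian n m) (A : Set (Eucl n)) : Set V.1 :=
  V.1.orthogonalProjectionOnto '' A

end ProjIntersect

end

/-! Let `diffMeasure μ ν` be the law of `x - y` under `μ × ν`; its characteristic function is
`charFun μ` times the conjugate of `charFun ν`. Restricting a characteristic function to an
`m`-plane gives that of the projected measure. If the projected supports are disjoint, the projected
difference measure misses a ball about the origin, so when its characteristic function is integrable
its integral (a multiple of the density at `0`) vanishes. For (1) it therefore suffices that on a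
positive measure set of planes this restriction is integrable with nonzero integral.

Averaging plane integrals over `O(n)` gives, up to a constant, integration against `‖x‖ ^ (m - n)`
on `ℝⁿ` (`map_orth_apply_eq_withDensity`). Finite energy bounds `∫ ‖charFun μ‖² ‖x‖ ^ (s - n)`
(`lintegral_charFun_sq_mul_rpow_lt_top`). Since `s + t = 2m`, the product of the two characteristic
functions is integrable against `‖x‖ ^ (m - n)`. That integral is nonzero because the Riesz kernel
is a positive mixture of Gaussians, and Gaussian means of a characteristic function are positive
(`integral_charFun_mul_rpow_ne_zero`).

For (2), exponents above `2m` make both restricted characteristic functions integrable on almost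
every plane, so the projected measures have continuous densities, up to constants `invCharFun`. By
Parseval the nonzero integral from (1), with both exponents equal to `m`, forces the densities to be
nonzero at a common point, hence on a common open set, which lies in both projections. -/

noncomputable section

namespace ProjIntersect

open Filter Topology Complex
open scoped RealInnerProductSpace ComplexConjugate ENNReal ContDiff FourierTransform

/-! ### Gaussian means of characteristic functions -/

section Regularisation

variable {E : Type*} [NormedAddCommGroup E] [InnerProductSpace ℝ E] [FiniteDimensional ℝ E]
  [MeasurableSpace E] [BorelSpace E]

/-- The Gaussian means of the characteristic function of a finite measure. -/
theorem integral_charFun_mul_gaussian (lam : Measure E) [IsFiniteMeasure lam] {r : ℝ}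
    (hr : 0 < r) :
    ∫ x, charFun lam x * (Real.exp (-r * ‖x‖ ^ 2) : ℂ) =
      (((Real.pi / r) ^ (Module.finrank ℝ E / 2 : ℝ) *
        ∫ z, Real.exp (-‖z‖ ^ 2 / (4 * r)) ∂lam : ℝ) : ℂ) := by
  have hre : 0 < (r : ℂ).re := by simpa using hr
  have hg : Integrable fun x : E => Real.exp (-r * ‖x‖ ^ 2) := by
    have := (GaussianFourier.integrable_cexp_neg_mul_sq_norm_add hre 0 (0 : E)).norm
    refine this.congr (.of_forall fun x => ?_)
    simp only [Complex.norm_exp]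
    congr 1
    norm_cast
    simp
  have hint : Integrable (fun p : E × E =>
      cexp (⟪p.2, p.1⟫ * I) * (Real.exp (-r * ‖p.1‖ ^ 2) : ℂ)) (volume.prod lam) := by
    refine (hg.mul_prod (integrable_const (1 : ℝ) : Integrable (fun _ => (1 : ℝ)) lam)).mono' ?_ ?_
    · exact Continuous.aestronglyMeasurable (by fun_prop)
    · refine .of_forall fun p => ?_
      rw [norm_mul, Complex.norm_exp_ofReal_mul_I]
      rw [Complex.norm_real, Real.norm_of_nonneg (Real.exp_pos _).le, one_mul, mul_one]
  calc ∫ x, charFun lam x * (Real.exp (-r * ‖x‖ ^ 2) : ℂ)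
      = ∫ x, ∫ z, cexp (⟪z, x⟫ * I) * (Real.exp (-r * ‖x‖ ^ 2) : ℂ) ∂lam := by
        simp_rw [charFun_apply, integral_mul_const]
    _ = ∫ z, (∫ x, cexp (⟪z, x⟫ * I) * (Real.exp (-r * ‖x‖ ^ 2) : ℂ)) ∂lam :=
        integral_integral_swap hint
    _ = ∫ z, (((Real.pi / r) ^ (Module.finrank ℝ E / 2 : ℝ) *
          Real.exp (-‖z‖ ^ 2 / (4 * r)) : ℝ) : ℂ) ∂lam := by
        refine integral_congr_ae (.of_forall fun z => ?_)
        have h := GaussianFourier.integral_cexp_neg_mul_sq_norm_add hre I z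
        have h' : ∀ x : E, cexp (⟪z, x⟫ * I) * (Real.exp (-r * ‖x‖ ^ 2) : ℂ) =
            cexp (-(r : ℂ) * ‖x‖ ^ 2 + I * ⟪z, x⟫) := fun x => by
          push_cast
          rw [← Complex.exp_add]
          ring_nf
        simp only [h', h]
        rw [ofReal_mul, ofReal_cpow (by positivity)]
        push_cast
        simp
    _ = _ := by rw [integral_complex_ofReal, integral_const_mul]

/-- Regularisation: the integral of an integrable characteristic function vanishes when the
measure does not charge a neighbourhood of the origin. -/
theorem integral_charFun_eq_zero (lam : Measure E) [IsFiniteMeasure lam]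
    (hi : Integrable (charFun lam)) {ρ : ℝ} (hρ : 0 < ρ) (h0 : lam (Metric.ball 0 ρ) = 0) :
    ∫ x, charFun lam x = 0 := by
  set d : ℝ := (Module.finrank ℝ E / 2 : ℝ)
  have h1 : Tendsto (fun r : ℝ => ∫ x, charFun lam x * (Real.exp (-r * ‖x‖ ^ 2) : ℂ)) (𝓝[>] 0)
      (𝓝 (∫ x, charFun lam x)) := by
    refine tendsto_integral_filter_of_dominated_convergence (fun x => ‖charFun lam x‖) ?_ ?_
      hi.norm ?_
    · exact .of_forall fun r => hi.1.mul (Continuous.aestronglyMeasurable (by fun_prop))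
    · filter_upwards [self_mem_nhdsWithin] with r hr
      refine .of_forall fun x => ?_
      rw [norm_mul]
      refine mul_le_of_le_one_right (norm_nonneg _) ?_
      rw [Complex.norm_real, Real.norm_eq_abs, abs_of_pos (Real.exp_pos _), Real.exp_le_one_iff]
      have : 0 < r := hr
      nlinarith [mul_nonneg this.le (sq_nonneg ‖x‖)]
    · refine .of_forall fun x => ?_
      have : Continuous fun r : ℝ => charFun lam x * (Real.exp (-r * ‖x‖ ^ 2) : ℂ) := by fun_prop
      simpa using (this.tendsto 0).mono_left nhdsWithin_le_nhds
  have h2 : Tendsto (fun r : ℝ => ∫ x, charFun lam x * (Real.exp (-r * ‖x‖ ^ 2) : ℂ)) (𝓝[>] 0)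
      (𝓝 0) := by
    -- Off the ball of radius `ρ` the Gaussian is at most `exp (-ρ² / (4r))`, which beats the factor
    -- `r ^ (-d)` as `r → 0`.
    have hbound : Tendsto (fun r : ℝ => Real.pi ^ d * (r⁻¹ ^ d * Real.exp (-(ρ ^ 2 / 4) * r⁻¹))
        * lam.real Set.univ) (𝓝[>] 0) (𝓝 (Real.pi ^ d * 0 * lam.real Set.univ)) := by
      have := (tendsto_rpow_mul_exp_neg_mul_atTop_nhds_zero d (ρ ^ 2 / 4) (by positivity)).comp
        tendsto_inv_nhdsGT_zero
      exact (this.const_mul _).mul_const _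
    rw [mul_zero, zero_mul] at hbound
    refine squeeze_zero_norm' ?_ hbound
    filter_upwards [self_mem_nhdsWithin] with r (hr : 0 < r)
    have hle : ∫ z, Real.exp (-‖z‖ ^ 2 / (4 * r)) ∂lam ≤
        ∫ z, Real.exp (-(ρ ^ 2 / 4) * r⁻¹) ∂lam := by
      have hae : ∀ᵐ z ∂lam, Real.exp (-‖z‖ ^ 2 / (4 * r)) ≤ Real.exp (-(ρ ^ 2 / 4) * r⁻¹) := by
        have : ∀ᵐ z ∂lam, z ∉ Metric.ball 0 ρ := measure_eq_zero_iff_ae_notMem.mp h0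
        filter_upwards [this] with z hz
        have hz : ρ ≤ ‖z‖ := by simpa using hz
        rw [Real.exp_le_exp]
        have : -(ρ ^ 2 / 4) * r⁻¹ = -ρ ^ 2 / (4 * r) := by field_simp
        rw [this]
        gcongr
      exact integral_mono_of_nonneg (.of_forall fun _ => (Real.exp_pos _).le)
        (integrable_const _) hae
    rw [integral_charFun_mul_gaussian lam hr, Complex.norm_real, Real.norm_of_nonneg (by positivity)]
    rw [integral_const, smul_eq_mul] at hle
    calc _ ≤ (Real.pi / r) ^ d * (lam.real Set.univ * Real.exp (-(ρ ^ 2 / 4) * r⁻¹)) := by gcongr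
      _ = _ := by
        rw [div_eq_mul_inv, Real.mul_rpow Real.pi_pos.le (by positivity)]
        ring
  exact tendsto_nhds_unique h1 h2

end Regularisation

/-! ### Measures with integrable characteristic function -/

section InverseTransform

theorem norm_cexp_neg_inner {F : Type*} [NormedAddCommGroup F] [InnerProductSpace ℝ F] (y u : F) :
    ‖cexp (-(⟪y, u⟫ * I))‖ = 1 := by
  have : -((⟪y, u⟫ : ℂ) * I) = ((-⟪y, u⟫ : ℝ) : ℂ) * I := by push_cast; ring
  rw [this, Complex.norm_exp_ofReal_mul_I]

variable {E : Type*} [NormedAddCommGroup E] [InnerProductSpace ℝ E] [FiniteDimensional ℝ E]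
  [MeasurableSpace E] [BorelSpace E]

/-- The (unnormalised) inverse Fourier transform of the characteristic function of a measure. -/
def invCharFun (ν : Measure E) (y : E) : ℂ := ∫ u, charFun ν u * cexp (-(⟪y, u⟫ * I))

theorem continuous_invCharFun {ν : Measure E} (hi : Integrable (charFun ν)) :
    Continuous (invCharFun ν) := by
  refine continuous_of_dominated (bound := fun u => ‖charFun ν u‖) (fun y => ?_) (fun y => ?_)
    hi.norm ?_
  · exact hi.1.mul (Continuous.aestronglyMeasurable (by fun_prop))
  · exact .of_forall fun u => by rw [norm_mul, norm_cexp_neg_inner, mul_one]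
  · exact .of_forall fun u => by fun_prop

/-- Translating by `-y` moves `y` to the origin and multiplies the characteristic function by the
phase in `invCharFun`, which reduces to `integral_charFun_eq_zero`. -/
theorem invCharFun_eq_zero {ν : Measure E} [IsFiniteMeasure ν] (hi : Integrable (charFun ν))
    {S : Set E} (hS : IsClosed S) (hν : ν Sᶜ = 0) {y : E} (hy : y ∉ S) : invCharFun ν y = 0 := by
  obtain ⟨ρ, hρ, hb⟩ := Metric.isOpen_iff.mp hS.isOpen_compl y hy
  have hc : ∀ u, charFun (ν.map (· + (-y))) u = charFun ν u * cexp (-(⟪y, u⟫ * I)) := fun u => by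
    rw [charFun_map_add_const]
    congr 2
    simp
  have hcf : charFun (ν.map (· + (-y))) = fun u => charFun ν u * cexp (-(⟪y, u⟫ * I)) := funext hc
  have : IsFiniteMeasure (ν.map (· + (-y))) := inferInstance
  have := integral_charFun_eq_zero (ν.map (· + (-y))) ?_ hρ ?_
  · rwa [hcf] at this
  · rw [hcf]
    refine hi.norm.mono' (hi.1.mul (Continuous.aestronglyMeasurable (by fun_prop))) ?_
    exact .of_forall fun u => by rw [norm_mul, norm_cexp_neg_inner, mul_one]
  · rw [Measure.map_apply (by fun_prop) measurableSet_ball]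
    refine measure_mono_null (fun x hx => hb ?_) hν
    simpa [dist_eq_norm, sub_eq_add_neg] using hx

/-- Fourier inversion for `φ` and two uses of Fubini turn `∫ φ dν` into a multiple of `∫ φ x *
invCharFun ν x`, whose integrand is zero everywhere. -/
theorem integral_eq_zero_of_invCharFun {ν : Measure E} [IsFiniteMeasure ν]
    (hi : Integrable (charFun ν)) {φ : E → ℂ} (hφ : ContDiff ℝ ∞ φ) (hc : HasCompactSupport φ)
    (h0 : ∀ x, φ x ≠ 0 → invCharFun ν x = 0) : ∫ x, φ x ∂ν = 0 := by
  let f : SchwartzMap E ℂ := hc.toSchwartzMap hφ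
  have hfφ : (f : E → ℂ) = φ := rfl
  have hφi : Integrable φ := f.integrable
  have hFi : Integrable (𝓕 φ) := (𝓕 f).integrable
  have hinv : 𝓕⁻ (𝓕 φ) = φ := Continuous.fourierInv_fourier_eq hφ.continuous hφi hFi
  -- `𝓕` carries `2π` in its exponent and `charFun` does not, hence the rescaling.
  have h2 : Integrable fun ξ : E => charFun ν ((2 * Real.pi) • ξ) :=
    hi.comp_smul (by positivity)
  calc ∫ y, φ y ∂ν = ∫ y, (∫ ξ, cexp (⟪y, (2 * Real.pi) • ξ⟫ * I) * 𝓕 φ ξ) ∂ν := by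
        refine integral_congr_ae (.of_forall fun y => ?_)
        conv_lhs => rw [← hinv]
        simp only [Real.fourierInv_eq', smul_eq_mul, real_inner_smul_right, real_inner_comm]
    _ = ∫ ξ, (∫ y, cexp (⟪y, (2 * Real.pi) • ξ⟫ * I) * 𝓕 φ ξ ∂ν) := by
        refine integral_integral_swap ?_
        refine ((integrable_const (1 : ℝ) : Integrable (fun _ => (1 : ℝ)) ν).mul_prod
          hFi.norm).mono' ?_ ?_
        · refine AEStronglyMeasurable.mul (Continuous.aestronglyMeasurable (by fun_prop)) ?_
          exact hFi.1.comp_snd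
        · refine .of_forall fun p => ?_
          simp only [Function.uncurry]
          rw [norm_mul, Complex.norm_exp_ofReal_mul_I]
    _ = ∫ ξ, 𝓕 φ ξ * charFun ν ((2 * Real.pi) • ξ) := by
        simp_rw [integral_mul_const, charFun_apply, mul_comm]
    _ = ∫ ξ, (∫ x, φ x * (charFun ν ((2 * Real.pi) • ξ) * cexp (-(⟪x, (2 * Real.pi) • ξ⟫ * I)))) := by
        refine integral_congr_ae (.of_forall fun ξ => ?_)
        simp only
        rw [Real.fourier_eq', ← integral_mul_const]
        refine integral_congr_ae (.of_forall fun x => ?_)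
        simp only [smul_eq_mul, real_inner_smul_right]
        have : (((-2 * Real.pi * ⟪x, ξ⟫ : ℝ) : ℂ) * I) = -(((2 * Real.pi * ⟪x, ξ⟫ : ℝ) : ℂ) * I) := by
          push_cast; ring
        rw [this]
        ring
    _ = ∫ x, (∫ ξ, φ x * (charFun ν ((2 * Real.pi) • ξ) * cexp (-(⟪x, (2 * Real.pi) • ξ⟫ * I)))) := by
        refine integral_integral_swap ?_
        refine (h2.norm.mul_prod hφi.norm).mono' ?_ ?_
        · refine AEStronglyMeasurable.mul hφi.1.comp_snd (AEStronglyMeasurable.mul h2.1.comp_fst ?_)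
          exact (Continuous.aestronglyMeasurable (by fun_prop))
        · refine .of_forall fun p => ?_
          simp only [Function.uncurry]
          rw [norm_mul, norm_mul, norm_cexp_neg_inner, mul_one, mul_comm]
    _ = 0 := by
        refine integral_eq_zero_of_ae (.of_forall fun x => ?_)
        simp only [Pi.zero_apply]
        rw [integral_const_mul]
        by_cases hx : φ x = 0
        · rw [hx, zero_mul]
        · have := Measure.integral_comp_smul (volume : Measure E)
            (fun u => charFun ν u * cexp (-(⟪x, u⟫ * I))) (2 * Real.pi)
          rw [this]
          have h := h0 x hx
          rw [invCharFun] at h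
          rw [h, smul_zero, mul_zero]

/-- A finite measure with integrable characteristic function does not charge an open set on which
the inverse Fourier transform vanishes. -/
theorem measure_eq_zero_of_invCharFun {ν : Measure E} [IsFiniteMeasure ν]
    (hi : Integrable (charFun ν)) {U : Set E} (hU : IsOpen U)
    (h0 : ∀ x ∈ U, invCharFun ν x = 0) : ν U = 0 := by
  refine measure_null_of_locally_null U fun y hy => ?_
  obtain ⟨ρ, hρ, hb⟩ := Metric.isOpen_iff.mp hU y hy
  let b : ContDiffBump y := ⟨ρ / 2, ρ, by positivity, by linarith⟩
  refine ⟨Metric.ball y ρ, mem_nhdsWithin_of_mem_nhds (Metric.ball_mem_nhds y hρ), ?_⟩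
  have hz : ∫ x, ((b x : ℝ) : ℂ) ∂ν = 0 := by
    refine integral_eq_zero_of_invCharFun hi (ofRealCLM.contDiff.comp b.contDiff)
      (b.hasCompactSupport.comp_left (g := fun r : ℝ => (r : ℂ)) rfl) fun x hx => h0 x (hb ?_)
    have : x ∈ Function.support b := by simpa using hx
    rwa [b.support_eq] at this
  rw [integral_complex_ofReal, ofReal_eq_zero] at hz
  have hbi : Integrable b ν := b.continuous.integrable_of_hasCompactSupport b.hasCompactSupport
  rw [integral_eq_zero_iff_of_nonneg (fun x => b.nonneg) hbi] at hz
  have := ae_iff.mp hz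
  rwa [show {a | ¬b a = (0 : E → ℝ) a} = Metric.ball y ρ from b.support_eq] at this

/-- Parseval's formula, by expanding the conjugated factor and applying Fubini. -/
theorem integral_charFun_mul_conj {μ ν : Measure E} [IsFiniteMeasure μ] [IsFiniteMeasure ν]
    (hi : Integrable (charFun μ)) :
    ∫ u, charFun μ u * conj (charFun ν u) = ∫ y, invCharFun μ y ∂ν := by
  calc ∫ u, charFun μ u * conj (charFun ν u)
      = ∫ u, (∫ y, charFun μ u * cexp (-(⟪y, u⟫ * I)) ∂ν) := by
        refine integral_congr_ae (.of_forall fun u => ?_)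
        simp only
        rw [integral_const_mul, ← charFun_neg, charFun_apply (μ := ν)]
        simp
    _ = _ := by
        refine integral_integral_swap ?_
        refine (hi.norm.mul_prod (integrable_const (1 : ℝ) :
          Integrable (fun _ => (1 : ℝ)) ν)).mono' ?_ ?_
        · exact hi.1.comp_fst.mul (Continuous.aestronglyMeasurable (by fun_prop))
        · refine .of_forall fun p => ?_
          simp only [Function.uncurry]
          rw [norm_mul, norm_cexp_neg_inner]

theorem interior_inter_nonempty {μ ν : Measure E} [IsFiniteMeasure μ] [IsFiniteMeasure ν]
    (hμ : Integrable (charFun μ)) (hν : Integrable (charFun ν))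
    (hne : ∫ u, charFun μ u * conj (charFun ν u) ≠ 0) {S T : Set E} (hS : IsClosed S)
    (hT : IsClosed T) (hμS : μ Sᶜ = 0) (hνT : ν Tᶜ = 0) : (interior (S ∩ T)).Nonempty := by
  have hcμ := continuous_invCharFun hμ
  have hcν := continuous_invCharFun hν
  -- Otherwise `invCharFun ν` vanishes on the open set where `invCharFun μ` does not; `ν` then gives
  -- that set no mass, and the Parseval integral is zero.
  obtain ⟨y, hy1, hy2⟩ : ∃ y, invCharFun μ y ≠ 0 ∧ invCharFun ν y ≠ 0 := by
    by_contra! hcon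
    have hU : IsOpen {y | invCharFun μ y ≠ 0} := isOpen_ne_fun hcμ continuous_const
    have h0 := measure_eq_zero_of_invCharFun hν hU hcon
    refine hne ?_
    rw [integral_charFun_mul_conj hμ]
    exact integral_eq_zero_of_ae h0
  refine ⟨y, mem_interior.mpr ⟨{y | invCharFun μ y ≠ 0} ∩ {y | invCharFun ν y ≠ 0}, ?_, 
    (isOpen_ne_fun hcμ continuous_const).inter (isOpen_ne_fun hcν continuous_const), hy1, hy2⟩⟩
  rintro x ⟨hx1, hx2⟩
  exact ⟨by_contra fun h => hx1 (invCharFun_eq_zero hμ hS hμS h),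
    by_contra fun h => hx2 (invCharFun_eq_zero hν hT hνT h)⟩

end InverseTransform

/-! ### Energies and Fourier decay -/

section Energy

theorem lintegral_rpow_mul_exp {a b : ℝ} (ha : 0 < a) (hb : 0 < b) :
    ∫⁻ r in Set.Ioi (0 : ℝ), ENNReal.ofReal (r ^ (a - 1) * Real.exp (-(b * r))) =
      ENNReal.ofReal ((1 / b) ^ a * Real.Gamma a) := by
  have h := Real.integral_rpow_mul_exp_neg_mul_Ioi ha hb
  have hG := Real.Gamma_pos_of_pos ha
  rw [← h, ofReal_integral_eq_lintegral_ofReal]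
  · exact .of_integral_ne_zero (by rw [h]; positivity)
  · filter_upwards [ae_restrict_mem measurableSet_Ioi] with r (hr : 0 < r)
    have := Real.rpow_pos_of_pos hr (a - 1)
    positivity

theorem lintegral_rpow_mul_exp_inv {a b : ℝ} (ha : 0 < a) (hb : 0 < b) :
    ∫⁻ r in Set.Ioi (0 : ℝ), ENNReal.ofReal (r ^ (-a - 1) * Real.exp (-(b / r))) =
      ENNReal.ofReal ((1 / b) ^ a * Real.Gamma a) := by
  have h := Real.integral_rpow_mul_exp_neg_mul_Ioi ha hb
  have hG := Real.Gamma_pos_of_pos ha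
  have h' : ∫ r in Set.Ioi (0 : ℝ), r ^ (-a - 1) * Real.exp (-(b / r)) =
      (1 / b) ^ a * Real.Gamma a := by
    -- Substitution `r ↦ r⁻¹` in the Gamma integral.
    rw [← h, ← integral_comp_rpow_Ioi _ (show (-1 : ℝ) ≠ 0 by norm_num)]
    refine setIntegral_congr_fun measurableSet_Ioi fun r (hr : 0 < r) => ?_
    simp only [smul_eq_mul, abs_neg, abs_one, one_mul]
    rw [← mul_assoc, ← Real.rpow_mul hr.le, ← Real.rpow_add hr, Real.rpow_neg_one, div_inv_eq_mul]
    congr 2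
    ring
  rw [← h', ofReal_integral_eq_lintegral_ofReal]
  · exact .of_integral_ne_zero (by rw [h']; positivity)
  · filter_upwards [ae_restrict_mem measurableSet_Ioi] with r (hr : 0 < r)
    have := Real.rpow_pos_of_pos hr (-a - 1)
    positivity

theorem lintegral_rpow_mul_exp_eq_top {a : ℝ} (ha : a ≤ 0) {b : ℝ} (hb : 0 ≤ b) :
    ∫⁻ r in Set.Ioi (0 : ℝ), ENNReal.ofReal (r ^ (a - 1) * Real.exp (-(b * r))) = ⊤ := by
  by_contra htop
  have hmeas : Measurable fun r : ℝ => r ^ (a - 1) * Real.exp (-(b * r)) := by fun_prop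
  have hi : IntegrableOn (fun r : ℝ => r ^ (a - 1) * Real.exp (-(b * r))) (Set.Ioi 0) := by
    refine ⟨hmeas.aestronglyMeasurable, ?_⟩
    rw [hasFiniteIntegral_iff_ofReal]
    · exact lt_top_iff_ne_top.mpr htop
    · filter_upwards [ae_restrict_mem measurableSet_Ioi] with r (hr : 0 < r)
      have := Real.rpow_pos_of_pos hr (a - 1)
      positivity
  -- On `(0, 1)` the exponential is at least `exp (-b)`, so integrability would pass to `r ^ (a -
  -- 1)`, which forces `a > 0`.
  have h2 : IntegrableOn (fun r : ℝ => r ^ (a - 1)) (Set.Ioo 0 1) := by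
    have h3 := (hi.mono_set (Set.Ioo_subset_Ioi_self : Set.Ioo (0 : ℝ) 1 ⊆ _)).const_mul (Real.exp b)
    refine h3.mono' (Measurable.aestronglyMeasurable (by fun_prop)) ?_
    filter_upwards [ae_restrict_mem measurableSet_Ioo] with r hr
    have := Real.rpow_pos_of_pos hr.1 (a - 1)
    rw [Real.norm_of_nonneg this.le, mul_left_comm, ← Real.exp_add]
    refine le_mul_of_one_le_right this.le (Real.one_le_exp ?_)
    nlinarith [hr.2]
  have := (intervalIntegral.integrableOn_Ioo_rpow_iff one_pos).mp h2
  linarith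

/-- Writes `‖z‖ ^ (-s)` as a mixture of Gaussians; at `z = 0` the right side is `⊤`, so the bound is
trivial there. -/
theorem lintegral_exp_inv_le {s : ℝ} (hs : 0 < s) {F : Type*} [NormedAddCommGroup F] (z : F) :
    ∫⁻ r in Set.Ioi (0 : ℝ), ENNReal.ofReal (r ^ (-(s / 2) - 1) * Real.exp (-(‖z‖ ^ 2 / 4 / r))) ≤
      ENNReal.ofReal (4 ^ (s / 2) * Real.Gamma (s / 2)) * ‖z‖ₑ ^ (-s) := by
  have hG := Real.Gamma_pos_of_pos (half_pos hs)
  rcases eq_or_ne z 0 with rfl | hz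
  · have : ENNReal.ofReal (4 ^ (s / 2) * Real.Gamma (s / 2)) ≠ 0 := by
      simp only [ne_eq, ENNReal.ofReal_eq_zero, not_le]; positivity
    simp [ENNReal.zero_rpow_of_neg (neg_lt_zero.mpr hs), ENNReal.mul_top this]
  · have hz' : 0 < ‖z‖ := norm_pos_iff.mpr hz
    rw [lintegral_rpow_mul_exp_inv (half_pos hs) (by positivity), ← ofReal_norm,
      ENNReal.ofReal_rpow_of_pos hz', ← ENNReal.ofReal_mul (by positivity)]
    refine ENNReal.ofReal_le_ofReal (le_of_eq ?_)
    have : (1 / (‖z‖ ^ 2 / 4)) ^ (s / 2) = 4 ^ (s / 2) * ‖z‖ ^ (-s) := by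
      rw [one_div_div, Real.div_rpow (by norm_num) (by positivity), ← Real.rpow_natCast,
        ← Real.rpow_mul hz'.le, Real.rpow_neg hz'.le, div_eq_mul_inv]
      congr 3
      push_cast; ring
    rw [this]
    ring

theorem continuous_charFun {F : Type*} [NormedAddCommGroup F]
    [InnerProductSpace ℝ F] [MeasurableSpace F] [BorelSpace F] [SecondCountableTopology F]
    (μ : Measure F) [IsFiniteMeasure μ] : Continuous (charFun μ) := by
  have : charFun μ = fun t => ∫ x, cexp (⟪x, t⟫ * I) ∂μ := funext charFun_apply
  rw [this]
  refine continuous_of_dominated (bound := fun _ => 1) (fun y => ?_) (fun y => ?_)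
    (integrable_const _) ?_
  · exact Continuous.aestronglyMeasurable (by fun_prop)
  · exact .of_forall fun u => by rw [Complex.norm_exp_ofReal_mul_I]
  · exact .of_forall fun u => by fun_prop

variable {E : Type*} [NormedAddCommGroup E] [InnerProductSpace ℝ E] [FiniteDimensional ℝ E]
  [MeasurableSpace E] [BorelSpace E]

/-- The distribution of `x - y` under `μ × ν`. -/
def diffMeasure (μ ν : Measure E) : Measure E := (μ.prod ν).map fun p => p.1 - p.2

instance (μ ν : Measure E) [IsFiniteMeasure μ] [IsFiniteMeasure ν] :
    IsFiniteMeasure (diffMeasure μ ν) := by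
  unfold diffMeasure; infer_instance

theorem charFun_diffMeasure (μ ν : Measure E) [IsFiniteMeasure μ] [IsFiniteMeasure ν] (t : E) :
    charFun (diffMeasure μ ν) t = charFun μ t * conj (charFun ν t) := by
  rw [diffMeasure, charFun_apply, integral_map (by fun_prop)
    (Continuous.aestronglyMeasurable (by fun_prop)), ← charFun_neg, charFun_apply, charFun_apply,
    ← integral_prod_mul]
  refine integral_congr_ae (.of_forall fun p => ?_)
  simp only [inner_sub_left, inner_neg_right]
  rw [← Complex.exp_add]
  push_cast
  ring_nf

/-- This is `integral_charFun_mul_gaussian` for `diffMeasure μ μ`, whose characteristic function is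
`‖charFun μ‖²`. -/
theorem lintegral_charFun_sq_mul_gaussian (μ : Measure E) [IsFiniteMeasure μ] {r : ℝ}
    (hr : 0 < r) :
    ∫⁻ x, ‖charFun μ x‖ₑ ^ 2 * ENNReal.ofReal (Real.exp (-(‖x‖ ^ 2 * r))) =
      ENNReal.ofReal ((Real.pi / r) ^ (Module.finrank ℝ E / 2 : ℝ)) *
        ∫⁻ y, ∫⁻ x, ENNReal.ofReal (Real.exp (-(‖x - y‖ ^ 2 / 4 / r))) ∂μ ∂μ := by
  have hG := integral_charFun_mul_gaussian (diffMeasure μ μ) hr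
  have h1 : ∀ x : E, charFun (diffMeasure μ μ) x * (Real.exp (-r * ‖x‖ ^ 2) : ℂ) =
      ((‖charFun μ x‖ ^ 2 * Real.exp (-(‖x‖ ^ 2 * r)) : ℝ) : ℂ) := fun x => by
    rw [charFun_diffMeasure, Complex.mul_conj, Complex.normSq_eq_norm_sq, ← ofReal_mul]
    ring_nf
  simp_rw [h1] at hG
  rw [integral_complex_ofReal, ofReal_inj] at hG
  have hgi : Integrable fun x : E => Real.exp (-(‖x‖ ^ 2 * r)) := by
    refine .of_integral_ne_zero ?_
    have := GaussianFourier.integral_rexp_neg_mul_sq_norm (V := E) hr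
    simp_rw [mul_comm (‖_‖ ^ 2) r, ← neg_mul, this]
    positivity
  have hi : Integrable fun x : E => ‖charFun μ x‖ ^ 2 * Real.exp (-(‖x‖ ^ 2 * r)) := by
    refine hgi.bdd_mul (c := μ.real Set.univ ^ 2)
      (((continuous_charFun μ).norm.pow 2).aestronglyMeasurable) (.of_forall fun x => ?_)
    rw [Real.norm_of_nonneg (by positivity)]
    gcongr
    exact norm_charFun_le x
  have h2 : ∫⁻ x, ‖charFun μ x‖ₑ ^ 2 * ENNReal.ofReal (Real.exp (-(‖x‖ ^ 2 * r))) =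
      ENNReal.ofReal (∫ x, ‖charFun μ x‖ ^ 2 * Real.exp (-(‖x‖ ^ 2 * r))) := by
    rw [ofReal_integral_eq_lintegral_ofReal hi (.of_forall fun x => by positivity)]
    refine lintegral_congr fun x => ?_
    rw [ENNReal.ofReal_mul (by positivity), ENNReal.ofReal_pow (norm_nonneg _), ofReal_norm]
  rw [h2, hG, ENNReal.ofReal_mul (by positivity)]
  congr 1
  rw [ofReal_integral_eq_lintegral_ofReal _ (.of_forall fun x => by positivity)]
  · rw [diffMeasure, lintegral_map (by fun_prop) (by fun_prop), lintegral_prod_symm' _ (by fun_prop)]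
    refine lintegral_congr fun y => lintegral_congr fun x => ?_
    congr 2
    field_simp
  · refine (integrable_const (1 : ℝ)).mono' (Continuous.aestronglyMeasurable (by fun_prop)) ?_
    refine .of_forall fun x => ?_
    rw [Real.norm_of_nonneg (Real.exp_pos _).le, Real.exp_le_one_iff, neg_div]
    have : 0 ≤ ‖x‖ ^ 2 / (4 * r) := by positivity
    linarith

/-- Integrate the preceding Gaussian identity in `r` against `r ^ ((n - s) / 2 - 1)`. The
`r`-integral on the left stays unevaluated so that `s ≥ n`, where it diverges, is covered too. -/
theorem lintegral_charFun_sq_le_energy {n : ℕ} (μ : Measure (Eucl n)) [IsFiniteMeasure μ] {s : ℝ}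
    (hs : 0 < s) :
    ∫⁻ x, ‖charFun μ x‖ₑ ^ 2 * (∫⁻ r in Set.Ioi (0 : ℝ),
        ENNReal.ofReal (r ^ ((n - s) / 2 - 1) * Real.exp (-(‖x‖ ^ 2 * r)))) ≤
      ENNReal.ofReal (Real.pi ^ (n / 2 : ℝ)) *
        (ENNReal.ofReal (4 ^ (s / 2) * Real.Gamma (s / 2)) * energy s μ) := by
  have hcm : Measurable (charFun μ) := (continuous_charFun μ).measurable
  calc _ = ∫⁻ x, ∫⁻ r in Set.Ioi (0 : ℝ), ‖charFun μ x‖ₑ ^ 2 *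
        ENNReal.ofReal (r ^ ((n - s) / 2 - 1) * Real.exp (-(‖x‖ ^ 2 * r))) := by
        refine lintegral_congr fun x => ?_
        rw [lintegral_const_mul _ (by fun_prop)]
    _ = ∫⁻ r in Set.Ioi (0 : ℝ), ∫⁻ x, ‖charFun μ x‖ₑ ^ 2 *
        ENNReal.ofReal (r ^ ((n - s) / 2 - 1) * Real.exp (-(‖x‖ ^ 2 * r))) := by
        refine lintegral_lintegral_swap (Measurable.aemeasurable ?_)
        simp only [Function.uncurry_def]
        fun_prop
    _ = ∫⁻ r in Set.Ioi (0 : ℝ), ∫⁻ y, ∫⁻ x, ENNReal.ofReal (Real.pi ^ (n / 2 : ℝ)) *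
          ENNReal.ofReal (r ^ (-(s / 2) - 1) * Real.exp (-(‖x - y‖ ^ 2 / 4 / r))) ∂μ ∂μ := by
        refine setLIntegral_congr_fun measurableSet_Ioi fun r (hr : 0 < r) => ?_
        have hr1 := Real.rpow_pos_of_pos hr ((n - s) / 2 - 1)
        have hr2 := Real.rpow_pos_of_pos hr (-(s / 2) - 1)
        have h1 : ∀ x : Eucl n, ‖charFun μ x‖ₑ ^ 2 *
            ENNReal.ofReal (r ^ ((n - s) / 2 - 1) * Real.exp (-(‖x‖ ^ 2 * r))) =
            ENNReal.ofReal (r ^ ((n - s) / 2 - 1)) *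
            (‖charFun μ x‖ₑ ^ 2 * ENNReal.ofReal (Real.exp (-(‖x‖ ^ 2 * r)))) := fun x => by
          rw [ENNReal.ofReal_mul hr1.le]; ring
        simp only [h1]
        rw [lintegral_const_mul _ (by fun_prop), lintegral_charFun_sq_mul_gaussian μ hr,
          ← mul_assoc, ← ENNReal.ofReal_mul hr1.le]
        have h2 : r ^ ((n - s) / 2 - 1) * (Real.pi / r) ^ (Module.finrank ℝ (Eucl n) / 2 : ℝ) =
            Real.pi ^ (n / 2 : ℝ) * r ^ (-(s / 2) - 1) := by
          rw [finrank_euclideanSpace_fin, Real.div_rpow Real.pi_pos.le hr.le,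
            div_eq_mul_inv (Real.pi ^ _), ← Real.rpow_neg hr.le, mul_left_comm, ← Real.rpow_add hr]
          congr 2
          ring
        have hm : Measurable fun p : Eucl n × Eucl n =>
            ENNReal.ofReal (Real.exp (-(‖p.2 - p.1‖ ^ 2 / 4 / r))) := by fun_prop
        rw [h2, ← lintegral_const_mul _ hm.lintegral_prod_right']
        refine lintegral_congr fun y => ?_
        rw [← lintegral_const_mul _ (by fun_prop)]
        refine lintegral_congr fun x => ?_
        rw [ENNReal.ofReal_mul (by positivity), ENNReal.ofReal_mul hr2.le, mul_assoc]
    _ = ∫⁻ y, ∫⁻ x, ENNReal.ofReal (Real.pi ^ (n / 2 : ℝ)) * (∫⁻ r in Set.Ioi (0 : ℝ),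
          ENNReal.ofReal (r ^ (-(s / 2) - 1) * Real.exp (-(‖x - y‖ ^ 2 / 4 / r)))) ∂μ ∂μ := by
        rw [lintegral_lintegral_swap]
        · refine lintegral_congr fun y => ?_
          rw [lintegral_lintegral_swap]
          · refine lintegral_congr fun x => ?_
            rw [lintegral_const_mul _ (by fun_prop)]
          · simp only [Function.uncurry_def]
            exact Measurable.aemeasurable (by fun_prop)
        · refine Measurable.aemeasurable ?_
          simp only [Function.uncurry_def]
          exact Measurable.lintegral_prod_right' (f := fun q : (ℝ × Eucl n) × Eucl n =>
            ENNReal.ofReal (Real.pi ^ (n / 2 : ℝ)) * ENNReal.ofReal (q.1.1 ^ (-(s / 2) - 1) *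
              Real.exp (-(‖q.2 - q.1.2‖ ^ 2 / 4 / q.1.1)))) (by fun_prop)
    _ ≤ ∫⁻ y, ∫⁻ x, ENNReal.ofReal (Real.pi ^ (n / 2 : ℝ)) *
          (ENNReal.ofReal (4 ^ (s / 2) * Real.Gamma (s / 2)) * ‖x - y‖ₑ ^ (-s)) ∂μ ∂μ := by
        gcongr
        exact lintegral_exp_inv_le hs _
    _ = _ := by
        rw [energy]
        simp_rw [← mul_assoc]
        have hm : Measurable fun p : Eucl n × Eucl n => ‖p.2 - p.1‖ₑ ^ (-s) := by fun_prop
        rw [← lintegral_const_mul _ (hm.lintegral_prod_right')]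
        refine lintegral_congr fun y => ?_
        rw [lintegral_const_mul _ (by fun_prop)]

/-- A nonzero finite measure on `ℝⁿ` has infinite `s`-energy for `s ≥ n`. -/
theorem lt_of_energy_lt_top {n : ℕ} {μ : Measure (Eucl n)} [IsFiniteMeasure μ] (hμ : μ ≠ 0) {s : ℝ}
    (hs : 0 < s) (hE : energy s μ < ⊤) : s < n := by
  by_contra! hsn
  have h := lintegral_charFun_sq_le_energy μ hs
  have hlt := h.trans_lt (ENNReal.mul_lt_top ENNReal.ofReal_lt_top
    (ENNReal.mul_lt_top ENNReal.ofReal_lt_top hE))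
  simp_rw [lintegral_rpow_mul_exp_eq_top (show (n - s) / 2 ≤ 0 by linarith) (sq_nonneg ‖_‖)] at hlt
  have hcm : Measurable (charFun μ) := (continuous_charFun μ).measurable
  rw [lintegral_mul_const _ (by fun_prop)] at hlt
  -- The divergent factor forces `charFun μ` to vanish almost everywhere, hence by continuity at
  -- `0`, where its value is the total mass.
  have h0 : ∫⁻ x, ‖charFun μ x‖ₑ ^ 2 = 0 := by
    by_contra hne
    rw [ENNReal.mul_top hne] at hlt
    exact lt_irrefl _ hlt
  rw [lintegral_eq_zero_iff (by fun_prop)] at h0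
  have h1 : charFun μ =ᵐ[volume] fun _ => 0 := by
    filter_upwards [h0] with x hx
    simpa using hx
  have h2 := congrFun (Continuous.ae_eq_iff_eq volume (continuous_charFun μ) continuous_const |>.mp h1) 0
  rw [charFun_zero] at h2
  have : μ.real Set.univ = 0 := by exact_mod_cast h2
  rw [measureReal_eq_zero_iff] at this
  exact hμ (Measure.measure_univ_eq_zero.mp this)

theorem lintegral_charFun_sq_mul_rpow_lt_top {n : ℕ} {μ : Measure (Eucl n)} [IsFiniteMeasure μ]
    {s : ℝ} (hs : 0 < s) (hsn : s < n) (hE : energy s μ < ⊤) :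
    ∫⁻ x, ‖charFun μ x‖ₑ ^ 2 * ENNReal.ofReal (‖x‖ ^ (s - n)) < ⊤ := by
  have h := lintegral_charFun_sq_le_energy μ hs
  have hlt := h.trans_lt (ENNReal.mul_lt_top ENNReal.ofReal_lt_top
    (ENNReal.mul_lt_top ENNReal.ofReal_lt_top hE))
  have ha : 0 < (n - s) / 2 := by linarith
  have hG := Real.Gamma_pos_of_pos ha
  have hn : Nontrivial (Eucl n) := by
    have : 0 < n := by exact_mod_cast hs.trans hsn
    have : Nonempty (Fin n) := ⟨⟨0, this⟩⟩
    infer_instance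
  have h0 : ∀ᵐ x : Eucl n, x ≠ 0 := by simp [ae_iff]
  have heq : ∫⁻ x, ‖charFun μ x‖ₑ ^ 2 * (∫⁻ r in Set.Ioi (0 : ℝ),
        ENNReal.ofReal (r ^ ((n - s) / 2 - 1) * Real.exp (-(‖x‖ ^ 2 * r)))) =
      (∫⁻ x, ‖charFun μ x‖ₑ ^ 2 * ENNReal.ofReal (‖x‖ ^ (s - n))) *
        ENNReal.ofReal (Real.Gamma ((n - s) / 2)) := by
    have hcm : Measurable (charFun μ) := (continuous_charFun μ).measurable
    rw [← lintegral_mul_const _ (by fun_prop)]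
    refine lintegral_congr_ae ?_
    filter_upwards [h0] with x hx
    have hx' : 0 < ‖x‖ := norm_pos_iff.mpr hx
    have hp : (1 / ‖x‖ ^ 2) ^ ((n - s) / 2) = ‖x‖ ^ (s - n) := by
      rw [one_div, ← Real.rpow_natCast, ← Real.rpow_neg hx'.le, ← Real.rpow_mul hx'.le]
      congr 1
      push_cast; ring
    rw [lintegral_rpow_mul_exp ha (by positivity), hp, ENNReal.ofReal_mul (by positivity), mul_assoc]
  rw [heq] at hlt
  by_contra htop
  rw [not_lt, top_le_iff] at htop
  rw [htop, ENNReal.top_mul (by simpa using hG)] at hlt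
  exact lt_irrefl _ hlt

end Energy

/-! ### Polar coordinates and averaging over rotations -/

section Polar

theorem lintegral_fun_norm {E : Type*} [NormedAddCommGroup E] [NormedSpace ℝ E]
    [MeasurableSpace E] [BorelSpace E] [FiniteDimensional ℝ E] [Nontrivial E] (μ : Measure E)
    [μ.IsAddHaarMeasure] {f : ℝ → ℝ≥0∞} (hf : Measurable f) :
    ∫⁻ x, f ‖x‖ ∂μ = μ.toSphere Set.univ *
      ∫⁻ y in Set.Ioi (0 : ℝ), ENNReal.ofReal (y ^ (Module.finrank ℝ E - 1)) * f y := by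
  calc ∫⁻ x, f ‖x‖ ∂μ = ∫⁻ x : ({(0)}ᶜ : Set E), f ‖x.1‖ ∂(μ.comap (↑)) := by
        rw [lintegral_subtype_comap (measurableSet_singleton _).compl fun x => f ‖x‖,
          restrict_compl_singleton]
    _ = ∫⁻ x, f x.2 ∂μ.toSphere.prod (.volumeIoiPow (Module.finrank ℝ E - 1)) := by
        simpa using μ.measurePreserving_homeomorphUnitSphereProd.lintegral_comp_emb
          (Homeomorph.measurableEmbedding _) (f ∘ Subtype.val ∘ Prod.snd)
    _ = μ.toSphere Set.univ * ∫⁻ x : Set.Ioi (0 : ℝ), f x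
          ∂.volumeIoiPow (Module.finrank ℝ E - 1) := by
        rw [lintegral_prod _ (by fun_prop)]
        dsimp only
        rw [lintegral_const, mul_comm]
    _ = _ := by
        rw [Measure.volumeIoiPow, lintegral_withDensity_eq_lintegral_mul _ (by fun_prop)
          (by fun_prop)]
        simp only [Pi.mul_apply]
        rw [lintegral_subtype_comap measurableSet_Ioi fun y : ℝ =>
          ENNReal.ofReal (y ^ (Module.finrank ℝ E - 1)) * f y]

instance (n : ℕ) : SecondCountableTopology (Eucl n →L[ℝ] Eucl n) :=
  have : ProperSpace (Eucl n →L[ℝ] Eucl n) := FiniteDimensional.proper ℝ _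
  inferInstance

instance (n : ℕ) : (orthHaar n).IsHaarMeasure := by
  unfold orthHaar; infer_instance

theorem orthHaar_univ (n : ℕ) : orthHaar n Set.univ = 1 := by
  simpa [orthHaar] using Measure.haarMeasure_self (G := OrthGroup n) (K₀ := ⊤)

instance (n : ℕ) : IsProbabilityMeasure (orthHaar n) := ⟨orthHaar_univ n⟩

instance (n : ℕ) : (orthHaar n).IsMulRightInvariant := by
  refine ⟨fun g => ?_⟩
  -- A right translate of Haar measure is again left invariant with total mass one, so uniqueness
  -- applies.
  have := Measure.haarMeasure_unique ((orthHaar n).map (· * g)) ⊤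
  rw [this, orthHaar, Measure.map_apply (measurable_mul_const g) (by simp)]
  have h := orthHaar_univ n
  rw [orthHaar] at h
  simp [h]

/-- Reflection in the hyperplane orthogonal to `x - y` exchanges `x` and `y`. -/
theorem exists_orth_apply_eq {n : ℕ} {x y : Eucl n} (h : ‖x‖ = ‖y‖) :
    ∃ g : OrthGroup n, (g : Eucl n →L[ℝ] Eucl n) x = y := by
  refine ⟨Unitary.linearIsometryEquiv.symm (Submodule.reflection (ℝ ∙ (x - y))ᗮ), ?_⟩
  exact Submodule.reflection_sub h

theorem norm_orth_apply {n : ℕ} (g : OrthGroup n) (x : Eucl n) :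
    ‖(g : Eucl n →L[ℝ] Eucl n) x‖ = ‖x‖ :=
  (Unitary.linearIsometryEquiv g).norm_map x

theorem measurePreserving_orth {n : ℕ} (g : OrthGroup n) :
    MeasurePreserving (fun x => (g : Eucl n →L[ℝ] Eucl n) x) :=
  (Unitary.linearIsometryEquiv g).measurePreserving

theorem continuous_orth_apply (n : ℕ) :
    Continuous fun p : OrthGroup n × Eucl n => (p.1 : Eucl n →L[ℝ] Eucl n) p.2 :=
  (continuous_subtype_val.comp continuous_fst).clm_apply continuous_snd

theorem lintegral_orth_apply_congr {n : ℕ} (f : Eucl n → ℝ≥0∞) {x y : Eucl n} (h : ‖x‖ = ‖y‖) :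
    ∫⁻ g : OrthGroup n, f ((g : Eucl n →L[ℝ] Eucl n) x) ∂orthHaar n =
      ∫⁻ g : OrthGroup n, f ((g : Eucl n →L[ℝ] Eucl n) y) ∂orthHaar n := by
  obtain ⟨k, rfl⟩ := exists_orth_apply_eq h
  exact (lintegral_mul_right_eq_self
    (fun g : OrthGroup n => f ((g : Eucl n →L[ℝ] Eucl n) x)) k).symm

/-- Integration over a random `m`-plane is integration over `ℝⁿ` against `|x|^(m - n)`. -/
theorem map_orth_apply_eq_withDensity {n m : ℕ} (hm : 0 < m) (hmn : m ≤ n)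
    (ι : Eucl m →ₗᵢ[ℝ] Eucl n) : ∃ c : ℝ≥0∞, c ≠ 0 ∧ c ≠ ⊤ ∧
      ((orthHaar n).prod (volume : Measure (Eucl m))).map
        (fun p => (p.1 : Eucl n →L[ℝ] Eucl n) (ι p.2)) =
      c • (volume : Measure (Eucl n)).withDensity fun x => ENNReal.ofReal (‖x‖ ^ ((m : ℝ) - n)) := by
  have hn : 0 < n := hm.trans_le hmn
  have : Nonempty (Fin m) := ⟨⟨0, hm⟩⟩
  have : Nonempty (Fin n) := ⟨⟨0, hn⟩⟩
  obtain ⟨e, he⟩ := exists_norm_eq (Eucl n) zero_le_one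
  set cm := (volume : Measure (Eucl m)).toSphere Set.univ with hcm
  set cn := (volume : Measure (Eucl n)).toSphere Set.univ with hcn
  have hcm0 : cm ≠ 0 := by
    rw [hcm, Ne, Measure.measure_univ_eq_zero]; exact Measure.toSphere_ne_zero _
  have hcn0 : cn ≠ 0 := by
    rw [hcn, Ne, Measure.measure_univ_eq_zero]; exact Measure.toSphere_ne_zero _
  have hcmt : cm ≠ ⊤ := measure_ne_top _ _
  have hcnt : cn ≠ ⊤ := measure_ne_top _ _
  have hcont := continuous_orth_apply n
  have hcι : Continuous fun p : OrthGroup n × Eucl m => (p.1 : Eucl n →L[ℝ] Eucl n) (ι p.2) :=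
    hcont.comp (continuous_fst.prodMk (ι.continuous.comp continuous_snd))
  have hw : Measurable fun x : Eucl n => ENNReal.ofReal (‖x‖ ^ ((m : ℝ) - n)) := by fun_prop
  -- The constant is the ratio of the total masses of the unit spheres of `ℝᵐ` and `ℝⁿ`.
  refine ⟨cm / cn, ENNReal.div_ne_zero.mpr ⟨hcm0, hcnt⟩, ENNReal.div_ne_top hcmt hcn0, ?_⟩
  refine Measure.ext_of_lintegral _ fun f hf => ?_
  -- The mean of `f` over the sphere of radius `r`; in polar coordinates both sides reduce to the
  -- same radial integral of `F`.
  let F : ℝ → ℝ≥0∞ := fun r => ∫⁻ g : OrthGroup n, f ((g : Eucl n →L[ℝ] Eucl n) (r • e)) ∂orthHaar n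
  have hF : Measurable F := by
    refine Measurable.lintegral_prod_right' (f := fun p : ℝ × OrthGroup n =>
      f ((p.2 : Eucl n →L[ℝ] Eucl n) (p.1 • e))) (hf.comp (Continuous.measurable ?_))
    exact hcont.comp (continuous_snd.prodMk (continuous_fst.smul continuous_const))
  have hFx : ∀ x : Eucl n, ∫⁻ g : OrthGroup n, f ((g : Eucl n →L[ℝ] Eucl n) x) ∂orthHaar n = F ‖x‖ :=
    fun x => lintegral_orth_apply_congr f (by simp [norm_smul, he])
  have hL : ∫⁻ x, f x ∂(((orthHaar n).prod (volume : Measure (Eucl m))).map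
        (fun p => (p.1 : Eucl n →L[ℝ] Eucl n) (ι p.2))) =
      cm * ∫⁻ y in Set.Ioi (0 : ℝ), ENNReal.ofReal (y ^ (m - 1)) * F y := by
    rw [lintegral_map hf hcι.measurable, lintegral_prod_symm'
      (fun p : OrthGroup n × Eucl m => f ((p.1 : Eucl n →L[ℝ] Eucl n) (ι p.2)))
      (hf.comp hcι.measurable)]
    simp_rw [hFx, ι.norm_map]
    rw [lintegral_fun_norm _ hF, finrank_euclideanSpace_fin]
  have hR : ∫⁻ x, f x ∂((volume : Measure (Eucl n)).withDensity
        fun x => ENNReal.ofReal (‖x‖ ^ ((m : ℝ) - n))) =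
      cn * ∫⁻ y in Set.Ioi (0 : ℝ), ENNReal.ofReal (y ^ (m - 1)) * F y := by
    rw [lintegral_withDensity_eq_lintegral_mul _ hw hf]
    simp only [Pi.mul_apply]
    -- Rotations preserve Lebesgue measure and the radial weight, so `f` may be replaced by its mean
    -- over `O(n)`.
    have h1 : ∀ g : OrthGroup n, ∫⁻ x : Eucl n, ENNReal.ofReal (‖x‖ ^ ((m : ℝ) - n)) * f x =
        ∫⁻ x : Eucl n, ENNReal.ofReal (‖x‖ ^ ((m : ℝ) - n)) * f ((g : Eucl n →L[ℝ] Eucl n) x) := by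
      intro g
      have := (measurePreserving_orth g).lintegral_comp (hw.mul hf)
      simp only [Pi.mul_apply, norm_orth_apply] at this
      exact this.symm
    have h2 : ∫⁻ x : Eucl n, ENNReal.ofReal (‖x‖ ^ ((m : ℝ) - n)) * f x =
        ∫⁻ g : OrthGroup n, (∫⁻ x : Eucl n, ENNReal.ofReal (‖x‖ ^ ((m : ℝ) - n)) *
          f ((g : Eucl n →L[ℝ] Eucl n) x)) ∂orthHaar n := by
      simp_rw [← h1]
      simp
    rw [h2, lintegral_lintegral_swap]
    · have h3 : ∀ x : Eucl n, ∫⁻ g : OrthGroup n, ENNReal.ofReal (‖x‖ ^ ((m : ℝ) - n)) *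
          f ((g : Eucl n →L[ℝ] Eucl n) x) ∂orthHaar n =
          ENNReal.ofReal (‖x‖ ^ ((m : ℝ) - n)) * F ‖x‖ := fun x => by
        rw [lintegral_const_mul, hFx]
        exact hf.comp (hcont.comp (continuous_id.prodMk continuous_const)).measurable
      simp_rw [h3]
      rw [lintegral_fun_norm _ (f := fun r => ENNReal.ofReal (r ^ ((m : ℝ) - n)) * F r)
        (by fun_prop), finrank_euclideanSpace_fin]
      congr 1
      refine setLIntegral_congr_fun measurableSet_Ioi fun y (hy : 0 < y) => ?_
      rw [← mul_assoc, ← ENNReal.ofReal_mul (by positivity), ← Real.rpow_natCast, ← Real.rpow_natCast,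
        ← Real.rpow_add hy]
      congr 3
      rw [Nat.cast_sub hm, Nat.cast_sub hn]
      push_cast
      ring
    · refine Measurable.aemeasurable ?_
      simp only [Function.uncurry_def]
      exact (hw.comp measurable_snd).mul (hf.comp hcont.measurable)
  rw [hL, lintegral_smul_measure, hR, smul_eq_mul, ← mul_assoc, ENNReal.div_mul_cancel hcn0 hcnt]

end Polar

/-! ### Nonvanishing and integrability on random planes -/

section Pairing

theorem diffMeasure_ne_zero {n : ℕ} {μ ν : Measure (Eucl n)} [IsFiniteMeasure μ]
    [IsFiniteMeasure ν] (hμ : μ ≠ 0) (hν : ν ≠ 0) : diffMeasure μ ν ≠ 0 := by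
  rw [diffMeasure, Ne, Measure.map_eq_zero_iff (by fun_prop), ← Measure.measure_univ_eq_zero,
    ← Set.univ_prod_univ, Measure.prod_prod, mul_eq_zero, Measure.measure_univ_eq_zero,
    Measure.measure_univ_eq_zero]
  tauto

/-- The characteristic function of a nonzero finite measure has nonzero integral against the Riesz
kernel `|x|^(m - n)`, by writing the kernel as a mixture of Gaussians. -/
theorem integral_charFun_mul_rpow_ne_zero {n : ℕ} {lam : Measure (Eucl n)} [IsFiniteMeasure lam]
    (hlam : lam ≠ 0) {m : ℝ} (hm : 0 < m) (hmn : m < n)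
    (hi : Integrable fun x => charFun lam x * ((‖x‖ ^ (m - n) : ℝ) : ℂ)) :
    ∫ x, charFun lam x * ((‖x‖ ^ (m - n) : ℝ) : ℂ) ≠ 0 := by
  have ha : 0 < (n - m) / 2 := by linarith
  set a := (n - m) / 2 with ha_def
  have hG := Real.Gamma_pos_of_pos ha
  have hn : Nontrivial (Eucl n) := by
    have : 0 < n := by exact_mod_cast hm.trans hmn
    have : Nonempty (Fin n) := ⟨⟨0, this⟩⟩
    infer_instance
  have h0 : ∀ᵐ x : Eucl n, x ≠ 0 := by simp [ae_iff]
  have hK : ∀ x : Eucl n, x ≠ 0 → ∫ r in Set.Ioi (0 : ℝ), r ^ (a - 1) * Real.exp (-(‖x‖ ^ 2 * r)) =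
      ‖x‖ ^ (m - n) * Real.Gamma a := fun x hx => by
    have hx' : 0 < ‖x‖ := norm_pos_iff.mpr hx
    rw [Real.integral_rpow_mul_exp_neg_mul_Ioi ha (by positivity), one_div, ← Real.rpow_natCast,
      ← Real.rpow_neg hx'.le, ← Real.rpow_mul hx'.le]
    congr 2
    rw [ha_def]
    push_cast; ring
  have hKi : ∀ x : Eucl n, x ≠ 0 → IntegrableOn
      (fun r : ℝ => r ^ (a - 1) * Real.exp (-(‖x‖ ^ 2 * r))) (Set.Ioi 0) := fun x hx => by
    have hx' : 0 < ‖x‖ := norm_pos_iff.mpr hx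
    exact .of_integral_ne_zero (by rw [hK x hx]; positivity)
  have hcm : Measurable (charFun lam) := (continuous_charFun lam).measurable
  have hprod : Integrable (fun p : Eucl n × ℝ => charFun lam p.1 *
      ((p.2 ^ (a - 1) * Real.exp (-(‖p.1‖ ^ 2 * p.2)) : ℝ) : ℂ))
      (volume.prod (volume.restrict (Set.Ioi 0))) := by
    rw [integrable_prod_iff (Measurable.aestronglyMeasurable (by fun_prop))]
    constructor
    · filter_upwards [h0] with x hx
      exact (hKi x hx).ofReal.const_mul _
    · refine (hi.norm.mul_const (Real.Gamma a)).congr ?_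
      filter_upwards [h0] with x hx
      have hx' : 0 < ‖x‖ := norm_pos_iff.mpr hx
      rw [norm_mul, Complex.norm_real, Real.norm_of_nonneg (by positivity), mul_assoc, ← hK x hx,
        ← integral_const_mul]
      refine setIntegral_congr_fun measurableSet_Ioi fun r (hr : 0 < r) => ?_
      have := Real.rpow_pos_of_pos hr (a - 1)
      rw [norm_mul, Complex.norm_real, Real.norm_of_nonneg (by positivity)]
  -- The Gaussian mean at parameter `r`, weighted by `r ^ (a - 1)`; it is strictly positive because
  -- `lam ≠ 0`.
  let h : ℝ → ℝ := fun r => r ^ (a - 1) * ((Real.pi / r) ^ (n / 2 : ℝ) *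
    ∫ z, Real.exp (-‖z‖ ^ 2 / (4 * r)) ∂lam)
  have hh : ∀ r ∈ Set.Ioi (0 : ℝ), ∫ x, charFun lam x *
      ((r ^ (a - 1) * Real.exp (-(‖x‖ ^ 2 * r)) : ℝ) : ℂ) = (h r : ℂ) := by
    intro r hr
    have hg := integral_charFun_mul_gaussian lam hr
    rw [finrank_euclideanSpace_fin] at hg
    simp only [h]
    rw [ofReal_mul, ← hg, ← integral_const_mul]
    refine integral_congr_ae (.of_forall fun x => ?_)
    simp only
    rw [ofReal_mul, show -(‖x‖ ^ 2 * r) = -r * ‖x‖ ^ 2 by ring]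
    ring
  have hpos : ∀ r ∈ Set.Ioi (0 : ℝ), 0 < h r := by
    intro r (hr : 0 < r)
    have h1 := Real.rpow_pos_of_pos hr (a - 1)
    have h2 : 0 < ∫ z, Real.exp (-‖z‖ ^ 2 / (4 * r)) ∂lam := by
      have hint : Integrable (fun z => Real.exp (-‖z‖ ^ 2 / (4 * r))) lam := by
        refine (integrable_const (1 : ℝ)).mono' (Continuous.aestronglyMeasurable (by fun_prop)) ?_
        refine .of_forall fun x => ?_
        rw [Real.norm_of_nonneg (Real.exp_pos _).le, Real.exp_le_one_iff, neg_div]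
        have : 0 ≤ ‖x‖ ^ 2 / (4 * r) := by positivity
        linarith
      rw [integral_pos_iff_support_of_nonneg (fun _ => (Real.exp_pos _).le) hint]
      have : Function.support (fun z : Eucl n => Real.exp (-‖z‖ ^ 2 / (4 * r))) = Set.univ :=
        Set.eq_univ_of_forall fun z => (Real.exp_pos _).ne'
      rw [this]
      exact Measure.measure_univ_pos.mpr hlam
    simp only [h]
    positivity
  have hhi : IntegrableOn h (Set.Ioi 0) := by
    have h1 := hprod.integral_prod_right
    have h2 : Integrable (fun r => (h r : ℂ)) (volume.restrict (Set.Ioi 0)) := by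
      refine h1.congr ?_
      filter_upwards [ae_restrict_mem measurableSet_Ioi] with r hr
      exact hh r hr
    exact h2.re
  have hmain : (∫ x, charFun lam x * ((‖x‖ ^ (m - n) : ℝ) : ℂ)) * (Real.Gamma a : ℂ) =
      ((∫ r in Set.Ioi (0 : ℝ), h r : ℝ) : ℂ) := by
    calc _ = ∫ x, (∫ r in Set.Ioi (0 : ℝ), charFun lam x *
          ((r ^ (a - 1) * Real.exp (-(‖x‖ ^ 2 * r)) : ℝ) : ℂ)) := by
          rw [← integral_mul_const]
          refine integral_congr_ae ?_
          filter_upwards [h0] with x hx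
          rw [integral_const_mul, integral_complex_ofReal, hK x hx, ofReal_mul]
          ring
      _ = ∫ r in Set.Ioi (0 : ℝ), (∫ x, charFun lam x *
          ((r ^ (a - 1) * Real.exp (-(‖x‖ ^ 2 * r)) : ℝ) : ℂ)) := integral_integral_swap hprod
      _ = ∫ r in Set.Ioi (0 : ℝ), (h r : ℂ) := setIntegral_congr_fun measurableSet_Ioi hh
      _ = _ := integral_complex_ofReal
  intro hz
  rw [hz, zero_mul, eq_comm, ofReal_eq_zero] at hmain
  have : 0 < ∫ r in Set.Ioi (0 : ℝ), h r := by
    rw [setIntegral_pos_iff_support_of_nonneg_ae _ hhi]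
    · have : Function.support h ∩ Set.Ioi 0 = Set.Ioi 0 :=
        Set.inter_eq_right.mpr fun r hr => (hpos r hr).ne'
      rw [this]
      simp
    · filter_upwards [ae_restrict_mem measurableSet_Ioi] with r hr
      exact (hpos r hr).le
  exact this.ne' hmain

/-- For a set of rotations of positive measure the characteristic function is integrable on the
rotated plane, with nonzero integral. -/
theorem frequently_integral_charFun_ne_zero {n m : ℕ} (hm : 0 < m) (hmn : m < n)
    (ι : Eucl m →ₗᵢ[ℝ] Eucl n) {lam : Measure (Eucl n)} [IsFiniteMeasure lam] (hlam : lam ≠ 0)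
    (hi : ∫⁻ x, ‖charFun lam x‖ₑ * ENNReal.ofReal (‖x‖ ^ ((m : ℝ) - n)) < ⊤) :
    ∃ᵐ g : OrthGroup n ∂orthHaar n,
      Integrable (fun u => charFun lam ((g : Eucl n →L[ℝ] Eucl n) (ι u))) ∧
      ∫ u, charFun lam ((g : Eucl n →L[ℝ] Eucl n) (ι u)) ≠ 0 := by
  obtain ⟨c, hc0, hct, hmap⟩ := map_orth_apply_eq_withDensity hm hmn.le ι
  have hcc := continuous_charFun lam
  have hcm : Measurable (charFun lam) := hcc.measurable
  have hw : Measurable fun x : Eucl n => ENNReal.ofReal (‖x‖ ^ ((m : ℝ) - n)) := by fun_prop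
  have hcι : Continuous fun p : OrthGroup n × Eucl m => (p.1 : Eucl n →L[ℝ] Eucl n) (ι p.2) :=
    (continuous_orth_apply n).comp (continuous_fst.prodMk (ι.continuous.comp continuous_snd))
  have hi1 : Integrable (fun x => charFun lam x * ((‖x‖ ^ ((m : ℝ) - n) : ℝ) : ℂ)) := by
    refine ⟨Measurable.aestronglyMeasurable (by fun_prop), ?_⟩
    rw [hasFiniteIntegral_iff_enorm]
    refine lt_of_eq_of_lt (lintegral_congr fun x => ?_) hi
    rw [enorm_mul, ← ofReal_norm ((_ : ℝ) : ℂ), Complex.norm_real, Real.norm_of_nonneg (by positivity)]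
  have hi2 : Integrable (charFun lam) (c • (volume : Measure (Eucl n)).withDensity
      fun x => ENNReal.ofReal (‖x‖ ^ ((m : ℝ) - n))) := by
    refine Integrable.smul_measure ⟨hcm.aestronglyMeasurable, ?_⟩ hct
    rw [hasFiniteIntegral_iff_enorm, lintegral_withDensity_eq_lintegral_mul _ hw (by fun_prop)]
    simpa only [Pi.mul_apply, mul_comm] using hi
  rw [← hmap] at hi2
  have hi3 := (integrable_map_measure hcm.aestronglyMeasurable hcι.measurable.aemeasurable).mp hi2
  have hne : ∫ x, charFun lam x ∂(((orthHaar n).prod (volume : Measure (Eucl m))).map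
        (fun p => (p.1 : Eucl n →L[ℝ] Eucl n) (ι p.2))) ≠ 0 := by
    rw [hmap, integral_smul_measure, integral_withDensity_eq_integral_toReal_smul hw
      (.of_forall fun _ => ENNReal.ofReal_lt_top)]
    refine smul_ne_zero (ENNReal.toReal_ne_zero.mpr ⟨hc0, hct⟩) ?_
    have := integral_charFun_mul_rpow_ne_zero hlam (m := m) (by exact_mod_cast hm)
      (by exact_mod_cast hmn) hi1
    convert! this using 3 with x
    rw [ENNReal.toReal_ofReal (by positivity), Complex.real_smul, mul_comm]
  rw [integral_map hcι.measurable.aemeasurable hcm.aestronglyMeasurable] at hne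
  change ∫ x, (charFun lam ∘ fun p : OrthGroup n × Eucl m =>
    (p.1 : Eucl n →L[ℝ] Eucl n) (ι p.2)) x ∂_ ≠ 0 at hne
  rw [integral_prod _ hi3] at hne
  -- If the integral vanished on almost every plane where it converges, so would its average over
  -- `O(n)`, contradicting `hne`.
  intro hcon
  refine hne (integral_eq_zero_of_ae ?_)
  filter_upwards [hcon, hi3.prod_right_ae] with g hg hgi
  by_contra hgne
  exact hg ⟨hgi, hgne⟩

/-- Since `m - n` is the mean of `s - n` and `t - n`, the inequality `ab ≤ a² + b²` bounds the
integrand by the sum of the two given ones. -/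
theorem lintegral_charFun_diffMeasure_lt_top {n : ℕ} {m s t : ℝ} (hmn : m < n)
    (hst : s + t = 2 * m) {μ ν : Measure (Eucl n)} [IsFiniteMeasure μ] [IsFiniteMeasure ν]
    (hμ : ∫⁻ x, ‖charFun μ x‖ₑ ^ 2 * ENNReal.ofReal (‖x‖ ^ (s - n)) < ⊤)
    (hν : ∫⁻ x, ‖charFun ν x‖ₑ ^ 2 * ENNReal.ofReal (‖x‖ ^ (t - n)) < ⊤) :
    ∫⁻ x, ‖charFun (diffMeasure μ ν) x‖ₑ * ENNReal.ofReal (‖x‖ ^ (m - n)) < ⊤ := by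
  have hcm : Measurable (charFun μ) := (continuous_charFun μ).measurable
  refine lt_of_le_of_lt (lintegral_mono fun x => ?_)
    ((lintegral_add_left (by fun_prop) _).trans_lt (ENNReal.add_lt_top.mpr ⟨hμ, hν⟩))
  rw [charFun_diffMeasure, ← ofReal_norm, ← ofReal_norm, ← ofReal_norm, norm_mul, RCLike.norm_conj,
    ← ENNReal.ofReal_pow (norm_nonneg _), ← ENNReal.ofReal_pow (norm_nonneg _),
    ← ENNReal.ofReal_mul (by positivity), ← ENNReal.ofReal_mul (by positivity),
    ← ENNReal.ofReal_mul (by positivity), ← ENNReal.ofReal_add (by positivity) (by positivity)]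
  refine ENNReal.ofReal_le_ofReal ?_
  rcases eq_or_ne x 0 with rfl | hx
  -- Real powers of zero with nonzero exponent are `0`, so the left side vanishes at the origin.
  · rw [norm_zero, Real.zero_rpow (by linarith : m - n ≠ 0), mul_zero]
    positivity
  · have hx' : 0 < ‖x‖ := norm_pos_iff.mpr hx
    set p := ‖x‖ ^ ((s - n) / 2) with hp
    set q := ‖x‖ ^ ((t - n) / 2) with hq
    have h1 : ‖x‖ ^ (s - n) = p * p := by rw [hp, ← Real.rpow_add hx']; ring_nf
    have h2 : ‖x‖ ^ (t - n) = q * q := by rw [hq, ← Real.rpow_add hx']; ring_nf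
    have h3 : ‖x‖ ^ (m - n) = p * q := by
      rw [hp, hq, ← Real.rpow_add hx']
      congr 1
      linarith
    rw [h1, h2, h3]
    nlinarith [sq_nonneg (‖charFun μ x‖ * p - ‖charFun ν x‖ * q), sq_nonneg (‖charFun μ x‖ * p),
      sq_nonneg (‖charFun ν x‖ * q)]

/-- By the averaging formula, the weight `‖x‖ ^ (σ - m)` on planes becomes `‖x‖ ^ (σ - n)` on `ℝⁿ`;
a finite average is finite almost everywhere. -/
theorem ae_lintegral_charFun_sq_lt_top {n m : ℕ} (hm : 0 < m) (hmn : m ≤ n)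
    (ι : Eucl m →ₗᵢ[ℝ] Eucl n) {μ : Measure (Eucl n)} [IsFiniteMeasure μ] {σ : ℝ}
    (hi : ∫⁻ x, ‖charFun μ x‖ₑ ^ 2 * ENNReal.ofReal (‖x‖ ^ (σ - n)) < ⊤) :
    ∀ᵐ g : OrthGroup n ∂orthHaar n,
      ∫⁻ u, ‖charFun μ ((g : Eucl n →L[ℝ] Eucl n) (ι u))‖ₑ ^ 2 *
        ENNReal.ofReal (‖u‖ ^ (σ - m)) < ⊤ := by
  obtain ⟨c, hc0, hct, hmap⟩ := map_orth_apply_eq_withDensity hm hmn ι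
  have hcm : Measurable (charFun μ) := (continuous_charFun μ).measurable
  have hw : Measurable fun x : Eucl n => ENNReal.ofReal (‖x‖ ^ ((m : ℝ) - n)) := by fun_prop
  have hcι : Measurable fun p : OrthGroup n × Eucl m => (p.1 : Eucl n →L[ℝ] Eucl n) (ι p.2) :=
    ((continuous_orth_apply n).comp
      (continuous_fst.prodMk (ι.continuous.comp continuous_snd))).measurable
  have : Nonempty (Fin n) := ⟨⟨0, hm.trans_le hmn⟩⟩
  have h0 : ∀ᵐ x : Eucl n, x ≠ 0 := by simp [ae_iff]
  let h : Eucl n → ℝ≥0∞ := fun x => ‖charFun μ x‖ₑ ^ 2 * ENNReal.ofReal (‖x‖ ^ (σ - m))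
  have hh : Measurable h := by fun_prop
  have h1 : ∫⁻ x, h x ∂(((orthHaar n).prod (volume : Measure (Eucl m))).map
        (fun p => (p.1 : Eucl n →L[ℝ] Eucl n) (ι p.2))) < ⊤ := by
    rw [hmap, lintegral_smul_measure, lintegral_withDensity_eq_lintegral_mul _ hw hh]
    refine ENNReal.mul_lt_top hct.lt_top (lt_of_eq_of_lt (lintegral_congr_ae ?_) hi)
    filter_upwards [h0] with x hx
    have hx' : 0 < ‖x‖ := norm_pos_iff.mpr hx
    simp only [Pi.mul_apply, h]
    rw [mul_left_comm, ← ENNReal.ofReal_mul (by positivity), ← Real.rpow_add hx']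
    congr 3
    ring
  rw [lintegral_map hh hcι] at h1
  have hhm : Measurable fun p : OrthGroup n × Eucl m =>
    h ((p.1 : Eucl n →L[ℝ] Eucl n) (ι p.2)) := hh.comp hcι
  rw [lintegral_prod _ hhm.aemeasurable] at h1
  filter_upwards [ae_lt_top hhm.lintegral_prod_right' h1.ne] with g hg
  simpa only [h, norm_orth_apply, ι.norm_map] using hg

/-- Cauchy–Schwarz against the weight `(1 + ‖u‖) ^ p`, whose inverse is integrable for `p` above the
dimension, used in pointwise form. -/
theorem integrable_of_lintegral_sq {E : Type*} [NormedAddCommGroup E] [NormedSpace ℝ E]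
    [FiniteDimensional ℝ E] [MeasurableSpace E] [BorelSpace E] (κ : Measure E)
    [κ.IsAddHaarMeasure] {φ : E → ℂ} (hφ : Measurable φ) {p : ℝ} (hp : Module.finrank ℝ E < p)
    (h1 : ∫⁻ u, ‖φ u‖ₑ ^ 2 ∂κ < ⊤) (h2 : ∫⁻ u, ‖φ u‖ₑ ^ 2 * ENNReal.ofReal (‖u‖ ^ p) ∂κ < ⊤) :
    Integrable φ κ := by
  have hp0 : 0 < p := (Nat.cast_nonneg _).trans_lt hp
  refine ⟨hφ.aestronglyMeasurable, ?_⟩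
  rw [hasFiniteIntegral_iff_enorm]
  have h3 := (integrable_one_add_norm (μ := κ) hp).lintegral_lt_top
  have hC : ENNReal.ofReal (2 ^ p) < ⊤ := ENNReal.ofReal_lt_top
  have h4 : ∫⁻ u, (ENNReal.ofReal (2 ^ p) * (‖φ u‖ₑ ^ 2 + ‖φ u‖ₑ ^ 2 * ENNReal.ofReal (‖u‖ ^ p)) +
      ENNReal.ofReal ((1 + ‖u‖) ^ (-p))) ∂κ < ⊤ := by
    rw [lintegral_add_right _ (by fun_prop), lintegral_const_mul _ (by fun_prop),
      lintegral_add_left (by fun_prop)]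
    exact ENNReal.add_lt_top.mpr ⟨ENNReal.mul_lt_top hC (ENNReal.add_lt_top.mpr ⟨h1, h2⟩), h3⟩
  refine lt_of_le_of_lt (lintegral_mono fun u => ?_) h4
  rw [← ofReal_norm, ← ENNReal.ofReal_pow (norm_nonneg _), ← ENNReal.ofReal_mul (by positivity),
    ← ENNReal.ofReal_add (by positivity) (by positivity), ← ENNReal.ofReal_mul (by positivity),
    ← ENNReal.ofReal_add (by positivity) (by positivity)]
  refine ENNReal.ofReal_le_ofReal ?_
  have hA : (1 + ‖u‖) ^ p ≤ 2 ^ p * (1 + ‖u‖ ^ p) := by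
    rcases le_total ‖u‖ 1 with hu | hu
    · calc (1 + ‖u‖) ^ p ≤ 2 ^ p := by gcongr; linarith
        _ ≤ _ := le_mul_of_one_le_right (by positivity) (by linarith [Real.rpow_nonneg (norm_nonneg u) p])
    · calc (1 + ‖u‖) ^ p ≤ (2 * ‖u‖) ^ p := by gcongr; linarith
        _ = 2 ^ p * ‖u‖ ^ p := Real.mul_rpow (by norm_num) (norm_nonneg _)
        _ ≤ _ := by gcongr; linarith
  have hpos : 0 < (1 + ‖u‖) ^ p := by positivity
  rw [Real.rpow_neg (by positivity)]
  set A := (1 + ‖u‖) ^ p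
  -- Expand `(‖φ u‖ A - 1)² / A ≥ 0`.
  have hAM : ‖φ u‖ ≤ ‖φ u‖ ^ 2 * A + A⁻¹ := by
    have h : 0 ≤ (‖φ u‖ * A - 1) ^ 2 * A⁻¹ := by positivity
    have h' : (‖φ u‖ * A - 1) ^ 2 * A⁻¹ = ‖φ u‖ ^ 2 * A - 2 * ‖φ u‖ + A⁻¹ := by field_simp; ring
    have := norm_nonneg (φ u)
    linarith
  calc ‖φ u‖ ≤ ‖φ u‖ ^ 2 * A + A⁻¹ := hAM
    _ ≤ ‖φ u‖ ^ 2 * (2 ^ p * (1 + ‖u‖ ^ p)) + A⁻¹ := by gcongr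
    _ = _ := by ring

/-- On a support of diameter at most `D`, `‖x - y‖ ^ (-a) ≤ D ^ (s - a) ‖x - y‖ ^ (-s)`; on the
diagonal the upper bound is `⊤`. -/
theorem energy_lt_top_of_le {n : ℕ} {μ : Measure (Eucl n)} (hμ : IsCompact μ.support) {a s : ℝ}
    (hs : 0 < s) (has : a ≤ s) (hE : energy s μ < ⊤) : energy a μ < ⊤ := by
  obtain ⟨D, hD0, hD⟩ : ∃ D : ℝ, 0 < D ∧ ∀ x ∈ μ.support, ∀ y ∈ μ.support, ‖x - y‖ ≤ D := by
    obtain ⟨C, hC⟩ := hμ.isBounded.exists_norm_le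
    refine ⟨|C| + |C| + 1, by positivity, fun x hx y hy => ?_⟩
    linarith [norm_sub_le x y, hC x hx, hC y hy, le_abs_self C]
  have hae : ∀ᵐ x ∂μ, x ∈ μ.support := Measure.support_mem_ae
  have hle : energy a μ ≤ ENNReal.ofReal (D ^ (s - a)) * energy s μ := by
    unfold energy
    rw [← lintegral_const_mul' _ _ ENNReal.ofReal_ne_top]
    refine lintegral_mono_ae ?_
    filter_upwards [hae] with y hy
    rw [← lintegral_const_mul' _ _ ENNReal.ofReal_ne_top]
    refine lintegral_mono_ae ?_
    filter_upwards [hae] with x hx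
    rcases eq_or_ne (x - y) 0 with hz | hz
    · have : ENNReal.ofReal (D ^ (s - a)) ≠ 0 := by
        simp only [ne_eq, ENNReal.ofReal_eq_zero, not_le]; positivity
      simp [hz, ENNReal.zero_rpow_of_neg (neg_lt_zero.mpr hs), ENNReal.mul_top this]
    · have hz' : 0 < ‖x - y‖ := norm_pos_iff.mpr hz
      rw [← ofReal_norm, ENNReal.ofReal_rpow_of_pos hz', ENNReal.ofReal_rpow_of_pos hz',
        ← ENNReal.ofReal_mul (by positivity)]
      refine ENNReal.ofReal_le_ofReal ?_
      calc ‖x - y‖ ^ (-a) = ‖x - y‖ ^ (s - a) * ‖x - y‖ ^ (-s) := by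
            rw [← Real.rpow_add hz']; ring_nf
        _ ≤ _ := by
            gcongr
            exact hD x hx y hy
  exact hle.trans_lt (ENNReal.mul_lt_top ENNReal.ofReal_lt_top hE)

end Pairing

/-! ### From Fourier integrals on planes to projections of supports -/

section Planes

theorem charFun_map_adjoint {n m : ℕ} (μ : Measure (Eucl n)) (L : Eucl m →L[ℝ] Eucl n)
    (u : Eucl m) :
    charFun (μ.map (ContinuousLinearMap.adjoint L)) u = charFun μ (L u) := by
  rw [charFun_apply, charFun_apply, integral_map (by fun_prop)
    (Continuous.aestronglyMeasurable (by fun_prop))]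
  simp_rw [ContinuousLinearMap.adjoint_inner_left]

theorem map_compl_image_eq_zero {X Y : Type*} [TopologicalSpace Y] [T2Space Y]
    [MeasurableSpace Y] [BorelSpace Y] [TopologicalSpace X] [MeasurableSpace X] [BorelSpace X]
    {μ : Measure X} {K : Set X} (hK : IsCompact K) (hμ : μ Kᶜ = 0) {f : X → Y}
    (hf : Continuous f) : μ.map f (f '' K)ᶜ = 0 := by
  rw [Measure.map_apply hf.measurable (hK.image hf).isClosed.isOpen_compl.measurableSet]
  exact measure_mono_null (fun x hx hxK => hx (Set.mem_image_of_mem f hxK)) hμ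

/-- In an isometric parametrisation of the plane `V`, the projection is the adjoint. -/
theorem projSet_eq_image {n m : ℕ} (V : Grassmannian n m) (L : Eucl m →ₗᵢ[ℝ] Eucl n)
    (hL : LinearMap.range L.toLinearMap = V.1) : ∃ ψ : Eucl m ≃ₜ V.1, ∀ A : Set (Eucl n),
      projSet V A = ψ '' (ContinuousLinearMap.adjoint L.toContinuousLinearMap '' A) := by
  obtain ⟨W, hW⟩ := V
  subst hL
  refine ⟨L.equivRange.toHomeomorph, fun A => ?_⟩
  change (LinearMap.range L.toLinearMap).orthogonalProjectionOnto '' A = _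
  rw [Set.image_image]
  refine Set.image_congr fun x _ => Subtype.ext ?_
  refine (Submodule.eq_starProjection_of_mem_of_inner_eq_zero
    (K := LinearMap.range L.toLinearMap) (Subtype.prop _) ?_)
  rintro _ ⟨u, rfl⟩
  have h := ContinuousLinearMap.adjoint_inner_left L.toContinuousLinearMap u x
  have h2 := L.inner_map_map (ContinuousLinearMap.adjoint L.toContinuousLinearMap x) u
  change ⟪x - L (ContinuousLinearMap.adjoint L.toContinuousLinearMap x), L u⟫ = 0
  rw [inner_sub_left, h2, h]
  exact sub_self _

/-- An isometric parametrisation of a plane by `ℝᵐ`. -/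
def planeParam {n m : ℕ} (V : Grassmannian n m) : Eucl m →ₗᵢ[ℝ] Eucl n :=
  V.1.subtypeₗᵢ.comp
    ((stdOrthonormalBasis ℝ V.1).reindex (finCongr V.2)).repr.symm.toLinearIsometry

theorem range_planeParam {n m : ℕ} (V : Grassmannian n m) :
    LinearMap.range (planeParam V).toLinearMap = V.1 := by
  ext x
  constructor
  · rintro ⟨u, rfl⟩
    exact Subtype.prop _
  · intro hx
    refine ⟨((stdOrthonormalBasis ℝ V.1).reindex (finCongr V.2)).repr ⟨x, hx⟩, ?_⟩
    change ((((stdOrthonormalBasis ℝ V.1).reindex (finCongr V.2)).repr.symm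
      (((stdOrthonormalBasis ℝ V.1).reindex (finCongr V.2)).repr ⟨x, hx⟩) : V.1) : Eucl n) = x
    rw [LinearIsometryEquiv.symm_apply_apply]

/-- The parametrisation of the rotated plane. -/
def rotatedParam {n m : ℕ} (g : OrthGroup n) (V : Grassmannian n m) : Eucl m →ₗᵢ[ℝ] Eucl n :=
  (Unitary.linearIsometryEquiv g).toLinearIsometry.comp (planeParam V)

theorem range_rotatedParam {n m : ℕ} (g : OrthGroup n) (V : Grassmannian n m) :
    LinearMap.range (rotatedParam g V).toLinearMap = (rotate g V).1 := by
  have h := LinearMap.range_comp (planeParam V).toLinearMap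
    (Unitary.linearIsometryEquiv g).toLinearEquiv.toLinearMap
  rw [range_planeParam V] at h
  exact h

/-- `Measure.le_map_apply` holds for arbitrary sets, so measurability of `A` is never needed. -/
theorem grassMeasure_pos_of_frequently {n m : ℕ} (h : m ≤ n) {A : Set (Grassmannian n m)}
    (hA : ∃ᵐ g ∂orthHaar n, rotate g (coordPlane h) ∈ A) : 0 < grassMeasure h A := by
  rw [frequently_ae_iff] at hA
  exact (pos_iff_ne_zero.mpr hA).trans_le
    (Measure.le_map_apply (continuous_rotate _).measurable.aemeasurable A)

theorem IsAdmissible.isFiniteMeasure {n : ℕ} {μ : Measure (Eucl n)}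
    (h : IsAdmissible Set.univ μ) : IsFiniteMeasure μ := ⟨h.lt_top⟩

theorem IsAdmissible.ne_zero {n : ℕ} {μ : Measure (Eucl n)}
    (h : IsAdmissible Set.univ μ) : μ ≠ 0 := Measure.measure_univ_pos.mp h.pos

theorem IsAdmissible.support_nonempty {n : ℕ} {μ : Measure (Eucl n)}
    (h : IsAdmissible Set.univ μ) : μ.support.Nonempty := by
  rw [Set.nonempty_iff_ne_empty]
  intro he
  have h0 := Measure.measure_compl_support (μ := μ)
  rw [he, Set.compl_empty] at h0
  exact h.pos.ne' h0

theorem inter_nonempty_of_integral_ne_zero {n m : ℕ} {μ ν : Measure (Eucl n)}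
    (hμ : IsAdmissible Set.univ μ) (hν : IsAdmissible Set.univ ν) (V : Grassmannian n m)
    (L : Eucl m →ₗᵢ[ℝ] Eucl n) (hL : LinearMap.range L.toLinearMap = V.1)
    (hi : Integrable fun u => charFun (diffMeasure μ ν) (L u))
    (hne : ∫ u, charFun (diffMeasure μ ν) (L u) ≠ 0) :
    (projSet V μ.support ∩ projSet V ν.support).Nonempty := by
  have := hμ.isFiniteMeasure
  have := hν.isFiniteMeasure
  obtain ⟨ψ, hψ⟩ := projSet_eq_image V L hL
  rw [hψ, hψ, ← Set.image_inter ψ.injective, Set.image_nonempty]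
  set T := ContinuousLinearMap.adjoint L.toContinuousLinearMap with hT
  by_contra hcon
  refine hne ?_
  set lam := (diffMeasure μ ν).map T with hlam
  have hch : charFun lam = fun u => charFun (diffMeasure μ ν) (L u) :=
    funext fun u => charFun_map_adjoint _ L.toContinuousLinearMap u
  have hc : Continuous fun p : Eucl n × Eucl n => T (p.1 - p.2) := by fun_prop
  set K := (fun p : Eucl n × Eucl n => T (p.1 - p.2)) '' (μ.support ×ˢ ν.support) with hK
  have hcomp := hμ.isCompact_support.prod hν.isCompact_support
  have hK0 : lam Kᶜ = 0 := by
    have : lam = (μ.prod ν).map fun p : Eucl n × Eucl n => T (p.1 - p.2) := by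
      rw [hlam, diffMeasure, Measure.map_map (by fun_prop) (by fun_prop)]
      rfl
    rw [this]
    refine map_compl_image_eq_zero hcomp ?_ hc
    rw [Set.compl_prod_eq_union]
    refine measure_union_null ?_ ?_ <;> simp [Measure.prod_prod]
  -- A zero difference would be a common point of the two projected supports. As `K` is compact, a
  -- whole ball about `0` avoids it.
  have h0K : (0 : Eucl m) ∈ Kᶜ := by
    rintro ⟨⟨x, y⟩, ⟨hx, hy⟩, hxy⟩
    refine hcon ⟨T x, ⟨x, hx, rfl⟩, ⟨y, hy, ?_⟩⟩
    simp only [map_sub] at hxy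
    exact (sub_eq_zero.mp hxy).symm
  obtain ⟨ρ, hρ, hb⟩ := Metric.isOpen_iff.mp (hcomp.image hc).isClosed.isOpen_compl 0 h0K
  have := integral_charFun_eq_zero lam (by rw [hch]; exact hi) hρ (measure_mono_null hb hK0)
  rwa [hch] at this

theorem interior_nonempty_of_integral_ne_zero {n m : ℕ} {μ ν : Measure (Eucl n)}
    (hμ : IsAdmissible Set.univ μ) (hν : IsAdmissible Set.univ ν) (V : Grassmannian n m)
    (L : Eucl m →ₗᵢ[ℝ] Eucl n) (hL : LinearMap.range L.toLinearMap = V.1)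
    (hiμ : Integrable fun u => charFun μ (L u)) (hiν : Integrable fun u => charFun ν (L u))
    (hne : ∫ u, charFun (diffMeasure μ ν) (L u) ≠ 0) :
    (interior (projSet V μ.support ∩ projSet V ν.support)).Nonempty := by
  have := hμ.isFiniteMeasure
  have := hν.isFiniteMeasure
  obtain ⟨ψ, hψ⟩ := projSet_eq_image V L hL
  rw [hψ, hψ, ← Set.image_inter ψ.injective, ← ψ.image_interior, Set.image_nonempty]
  set T := ContinuousLinearMap.adjoint L.toContinuousLinearMap with hT
  have hch : ∀ κ : Measure (Eucl n), charFun (κ.map T) = fun u => charFun κ (L u) :=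
    fun κ => funext fun u => charFun_map_adjoint _ L.toContinuousLinearMap u
  have hTc : Continuous T := T.continuous
  refine interior_inter_nonempty (μ := μ.map T) (ν := ν.map T) (by rw [hch]; exact hiμ)
    (by rw [hch]; exact hiν) ?_ (hμ.isCompact_support.image hTc).isClosed
    (hν.isCompact_support.image hTc).isClosed
    (map_compl_image_eq_zero hμ.isCompact_support Measure.measure_compl_support hTc)
    (map_compl_image_eq_zero hν.isCompact_support Measure.measure_compl_support hTc)
  simp only [hch]
  simpa only [charFun_diffMeasure] using hne

/-- Energy exponent `m` gives the unweighted square integral on the plane and exponent `s` the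
weight `‖u‖ ^ (s - m)`; the condition `s > 2m` is exactly `s - m > m`. -/
theorem ae_integrable_charFun {n m : ℕ} (hm : 0 < m) (hmn : m < n) {μ : Measure (Eucl n)}
    (hμ : IsAdmissible Set.univ μ) {s : ℝ} (hs : 2 * (m : ℝ) < s) (hsn : s < n)
    (hE : energy s μ < ⊤) (ι : Eucl m →ₗᵢ[ℝ] Eucl n) :
    ∀ᵐ g : OrthGroup n ∂orthHaar n,
      Integrable fun u => charFun μ ((g : Eucl n →L[ℝ] Eucl n) (ι u)) := by
  have := hμ.isFiniteMeasure
  have hm' : (0 : ℝ) < m := by exact_mod_cast hm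
  have hEm : energy m μ < ⊤ :=
    energy_lt_top_of_le hμ.isCompact_support (by linarith) (by linarith) hE
  have h1 := ae_lintegral_charFun_sq_lt_top hm hmn.le ι
    (lintegral_charFun_sq_mul_rpow_lt_top (by linarith) hsn hE)
  have h2 := ae_lintegral_charFun_sq_lt_top hm hmn.le ι
    (lintegral_charFun_sq_mul_rpow_lt_top hm' (by exact_mod_cast hmn) hEm)
  filter_upwards [h1, h2] with g hg1 hg2
  refine integrable_of_lintegral_sq volume (p := s - m) ?_ ?_ ?_ hg1
  · exact ((continuous_charFun μ).comp
      ((g : Eucl n →L[ℝ] Eucl n).continuous.comp ι.continuous)).measurable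
  · rw [finrank_euclideanSpace_fin]; linarith
  · simpa using hg2

theorem frequently_integral_ne_zero {n m : ℕ} (hm : 0 < m) (hmn : m < n)
    {μ ν : Measure (Eucl n)} (hμ : IsAdmissible Set.univ μ) (hν : IsAdmissible Set.univ ν)
    {s t : ℝ} (hs : 0 < s) (ht : 0 < t) (hst : s + t = 2 * (m : ℝ)) (hEμ : energy s μ < ⊤)
    (hEν : energy t ν < ⊤) (ι : Eucl m →ₗᵢ[ℝ] Eucl n) :
    ∃ᵐ g : OrthGroup n ∂orthHaar n,
      Integrable (fun u => charFun (diffMeasure μ ν) ((g : Eucl n →L[ℝ] Eucl n) (ι u))) ∧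
      ∫ u, charFun (diffMeasure μ ν) ((g : Eucl n →L[ℝ] Eucl n) (ι u)) ≠ 0 := by
  have := hμ.isFiniteMeasure
  have := hν.isFiniteMeasure
  refine frequently_integral_charFun_ne_zero hm hmn ι (diffMeasure_ne_zero hμ.ne_zero hν.ne_zero) ?_
  exact lintegral_charFun_diffMeasure_lt_top (by exact_mod_cast hmn) hst
    (lintegral_charFun_sq_mul_rpow_lt_top hs (lt_of_energy_lt_top hμ.ne_zero hs hEμ) hEμ)
    (lintegral_charFun_sq_mul_rpow_lt_top ht (lt_of_energy_lt_top hν.ne_zero ht hEν) hEν)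

end Planes

end ProjIntersect

end

/-! ### The theorem -/

open ProjIntersect in
theorem mainTheorem6 (n m : ℕ) (hmn : m ≤ n) (μ ν : MeasureTheory.Measure (ProjIntersect.Eucl n))
    (hμ : ProjIntersect.IsAdmissible Set.univ μ) (hν : ProjIntersect.IsAdmissible Set.univ ν) :
    (∀ s t : ℝ, 0 < s → 0 < t → s + t = 2 * (m : ℝ) → ProjIntersect.energy s μ < ⊤ → ProjIntersect.energy t ν < ⊤ →
      0 < ProjIntersect.grassMeasure hmn
        {V | (ProjIntersect.projSet V μ.support ∩ ProjIntersect.projSet V ν.support).Nonempty}) ∧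
    (∀ s t : ℝ, 2 * (m : ℝ) < s → 2 * (m : ℝ) < t → ProjIntersect.energy s μ < ⊤ → ProjIntersect.energy t ν < ⊤ →
      0 < ProjIntersect.grassMeasure hmn
        {V | (interior (ProjIntersect.projSet V μ.support ∩ ProjIntersect.projSet V ν.support)).Nonempty}) := by
  have := hμ.isFiniteMeasure
  have := hν.isFiniteMeasure
  constructor
  · intro s t hs ht hst hEμ hEν
    have hsn := lt_of_energy_lt_top hμ.ne_zero hs hEμ
    have htn := lt_of_energy_lt_top hν.ne_zero ht hEν
    -- Positivity of `s + t = 2m` excludes `m = 0`; finite energy forces `s, t < n`, so `m < n`.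
    have hm : 0 < m := by
      have : (0 : ℝ) < m := by linarith
      exact_mod_cast this
    have hmn' : m < n := by
      have : (m : ℝ) < n := by linarith
      exact_mod_cast this
    refine grassMeasure_pos_of_frequently hmn ?_
    refine (frequently_integral_ne_zero hm hmn' hμ hν hs ht hst hEμ hEν
      (planeParam (coordPlane hmn))).mono fun g hg => ?_
    exact inter_nonempty_of_integral_ne_zero hμ hν _ (rotatedParam g (coordPlane hmn))
      (range_rotatedParam _ _) hg.1 hg.2
  · intro s t hs ht hEμ hEν
    rcases Nat.eq_zero_or_pos m with rfl | hm
    -- For `m = 0` the plane is a single point, and nonempty supports project onto all of it.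
    · have huniv : {V : Grassmannian n 0 |
          (interior (projSet V μ.support ∩ projSet V ν.support)).Nonempty} = Set.univ := by
        refine Set.eq_univ_of_forall fun V => ?_
        have : Subsingleton V.1 := Module.finrank_zero_iff.mp V.2
        have h1 : projSet V μ.support = Set.univ := (hμ.support_nonempty.image _).eq_univ
        have h2 : projSet V ν.support = Set.univ := (hν.support_nonempty.image _).eq_univ
        simp [h1, h2]
      rw [huniv, MeasureTheory.measure_univ]
      exact one_pos
    · have hm' : (0 : ℝ) < m := by exact_mod_cast hm
      have hsn := lt_of_energy_lt_top hμ.ne_zero (by linarith) hEμ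
      have htn := lt_of_energy_lt_top hν.ne_zero (by linarith) hEν
      have hmn' : m < n := by
        have : (m : ℝ) < n := by linarith
        exact_mod_cast this
      -- Lowering both exponents to `m` makes their sum `2m`, so the nonvanishing from (1) applies.
      have hEμ' : energy m μ < ⊤ :=
        energy_lt_top_of_le hμ.isCompact_support (by linarith) (by linarith) hEμ
      have hEν' : energy m ν < ⊤ :=
        energy_lt_top_of_le hν.isCompact_support (by linarith) (by linarith) hEν
      refine grassMeasure_pos_of_frequently hmn ?_
      refine ((frequently_integral_ne_zero hm hmn' hμ hν hm' hm' (by ring) hEμ' hEν'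
        (planeParam (coordPlane hmn))).and_eventually
        ((ae_integrable_charFun hm hmn' hμ hs hsn hEμ (planeParam (coordPlane hmn))).and
          (ae_integrable_charFun hm hmn' hν ht htn hEν (planeParam (coordPlane hmn))))).mono
        fun g hg => ?_
      exact interior_nonempty_of_integral_ne_zero hμ hν _ (rotatedParam g (coordPlane hmn))
        (range_rotatedParam _ _) hg.2.1 hg.2.2 hg.1.2
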